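/- Let $d\ge 0$ be fixed, $V=\{1,\dots,d\}$, and let $F:2^V\to[0,+\infty]$ be a monotone set function ($A\subseteq B\Rightarrow F(A)\le F(B)$) with $F(\varnothing)=0$, $F(A)>0$ for $A\neq\varnothing$, and such that the sets $A$ with $F(A)<+\infty$ cover $V$. Let $p\in(1,\infty]$, $\frac1p+\frac1q=1$. For $w\in\mathbb R^d$ let $\mathrm{supp}(w)=\{i:w_i\ne0\}$ and $$F_p(w)=\tfrac1q F(\mathrm{supp}(w))+\tfrac1p\|w\|_p^p\quad(p<\infty),\qquad F_\infty(w)=F(\mathrm{supp}(w))+\iota_{\{\|w\|_\infty\le1\}}(w).$$ Let $\Theta_p$ be the convex envelope (Fenchel biconjugate) of $F_p$, and let $\Omega_p$ be the convex envelope (Fenchel biconjugate) of the positively homogeneous envelope $w\mapsto F(\mathrm{supp}(w))^{1/q}\|w\|_p$ of $F_p$. Let $\Phi=\Omega_p$ or $\Phi=\Theta_p$. A set $J\subseteq V$ is strongly stable with respect to $F$ if $F(A\cup\{i\})>F(A)$ for all $A\subseteq J$ and $i\in V\setminus J$. Linear model. Let $w^*\in\mathbb R^d$, $J=\mathrm{supp}(w^*)$,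 and for every $n$ let $y_n=X_nw^*+(\epsilon_1,\dots,\epsilon_n)^\top$, where $\epsilon_1,\epsilon_2,\dots$ are i.i.d. real random variables with mean $0$ and variance $\sigma^2$, and $X_n\in\mathbb R^{n\times d}$ are deterministic with $X_n^\top X_n/n\to Q\succ0$. Assume that $X_n$ consists of the first $n$ rows of one fixed infinite matrix or, for a general array $(X_n)$, that $\max_{i,j}(X_n)_{ij}^2/n\to0$ (which holds automatically in the first case). Estimator. Let $\alpha\in(0,1)$, and let $w^0=w^0_n$ be random vectors with $\sqrt n(w^0_n-w^*)=O_P(1)$. Let $\lambda_n>0$ satisfy $\lambda_n/\sqrt n\to0$ and $\lambda_n/n^{\alpha/2}\to\infty$. Let $\hat w_n$ be a random vector which, for all large $n$ and almost surely, is a minimizer of $$\min_{w\in\mathbb R^d}\ \tfrac12\|y_n-X_nw\|_2^2+\lambda_n\Phi\big(|w^0_n|^{\alpha-1}\circ|w|\big),$$ with entrywise operations; if $w^0_{n,i}=0$ the weight of coordinate $i$ is $+\infty$, i.e. the penalty is $+\infty$ whenever $w_i\ne0$, while the coordinate contributes $0$ if $w_i=0$. Claim. Suppose that $J$ is strongly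 stable with respect to $F$. If $p=\infty$, suppose moreover that $\|w^*\|_\infty<1$, and, in the case $\Phi=\Theta_\infty$, that $F(J)<+\infty$ (this last condition follows from strong stability unless $J=V$). Then $\hat w_n$ is consistent, asymptotically normal and recovers the support: $$\hat w_n\xrightarrow{P}w^*,\qquad \sqrt n\,(\hat w_{n,J}-w^*_J)\xrightarrow{d}\mathcal N\big(0,\sigma^2Q_{JJ}^{-1}\big),\qquad P\big(\mathrm{supp}(\hat w_n)=J\big)\to1 ,$$ where $v_J=(v_i)_{i\in J}$ and $Q_{JJ}=(Q_{ij})_{i,j\in J}$. -/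

import Mathlib

open MeasureTheory ProbabilityTheory Filter Topology
open scoped ENNReal Matrix

namespace CombPenalty

noncomputable section

/-- The support of a vector `w ∈ ℝ^d`. -/
def supp {d : ℕ} (w : Fin d → ℝ) : Finset (Fin d) :=
  Finset.univ.filter fun i => w i ≠ 0

/-- The standing assumptions on a monotone set function `F : 2^V → [0, ∞]`:
`F ∅ = 0`, `F A > 0` for nonempty `A`, `F` is monotone, and the sets on which `F` is finite
cover the ground set. -/
structure IsCombPenalty {d : ℕ} (F : Finset (Fin d) → ℝ≥0∞) : Prop where
  empty : F ∅ = 0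
  pos : ∀ A : Finset (Fin d), A.Nonempty → 0 < F A
  mono : ∀ A B : Finset (Fin d), A ⊆ B → F A ≤ F B
  cover : ∀ i : Fin d, ∃ A : Finset (Fin d), i ∈ A ∧ F A < ∞

/-- `J` is (discretely) strongly stable with respect to `F`. -/
def IsStronglyStable {d : ℕ} (F : Finset (Fin d) → ℝ≥0∞) (J : Finset (Fin d)) : Prop :=
  ∀ A : Finset (Fin d), A ⊆ J → ∀ i : Fin d, i ∉ J → F A < F (insert i A)

/-- The Fenchel conjugate `f*(s) = sup_w (⟨w, s⟩ - f w)` of an extended-real-valued function. -/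
def fenchelConj {d : ℕ} (f : (Fin d → ℝ) → EReal) (s : Fin d → ℝ) : EReal :=
  ⨆ w : Fin d → ℝ, ((w ⬝ᵥ s : ℝ) : EReal) - f w

/-- The convex envelope of `f`, given by the Fenchel biconjugate `f**`. -/
def convexEnvelope {d : ℕ} (f : (Fin d → ℝ) → EReal) : (Fin d → ℝ) → EReal :=
  fenchelConj (fenchelConj f)

/-- The `ℓ_p`-regularized combinatorial penalty
`F_p(w) = (1/q) F(supp w) + (1/p) ‖w‖_p^p`, with `q` the conjugate exponent of `p`; for `p = ∞`
it is `F(supp w)` plus the indicator function of the unit `ℓ_∞`-ball. -/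
def lpPenalty {d : ℕ} (F : Finset (Fin d) → ℝ≥0∞) (p : ℝ≥0∞) (w : Fin d → ℝ) : ℝ≥0∞ :=
  if p = ∞ then
    F (supp w) + (if ‖WithLp.toLp p w‖ ≤ 1 then 0 else ∞)
  else
    (ENNReal.conjExponent p)⁻¹ * F (supp w)
      + p⁻¹ * ENNReal.ofReal (‖WithLp.toLp p w‖ ^ p.toReal)

/-- The positively homogeneous envelope `F(supp w)^{1/q} ‖w‖_p` of `F_p`. -/
def homPenalty {d : ℕ} (F : Finset (Fin d) → ℝ≥0∞) (p : ℝ≥0∞) (w : Fin d → ℝ) : ℝ≥0∞ :=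
  F (supp w) ^ ((ENNReal.conjExponent p)⁻¹).toReal * ENNReal.ofReal ‖WithLp.toLp p w‖

/-- The homogeneous convex envelope `Ω_p`. -/
def omegaEnv {d : ℕ} (F : Finset (Fin d) → ℝ≥0∞) (p : ℝ≥0∞) : (Fin d → ℝ) → EReal :=
  convexEnvelope fun w => (homPenalty F p w : EReal)

/-- The non-homogeneous convex envelope `Θ_p`. -/
def thetaEnv {d : ℕ} (F : Finset (Fin d) → ℝ≥0∞) (p : ℝ≥0∞) : (Fin d → ℝ) → EReal :=
  convexEnvelope fun w => (lpPenalty F p w : EReal)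

/-- The adaptively weighted penalty `Φ(|w⁰|^{α-1} ∘ |w|)` for `α < 1`. A weight at a coordinate
with `w⁰ i = 0` is `+∞`: it contributes nothing where `w i = 0`, and makes the penalty infinite
where `w i ≠ 0`. -/
def adaptivePenalty {d : ℕ} (Φ : (Fin d → ℝ) → EReal) (α : ℝ) (w₀ w : Fin d → ℝ) : EReal :=
  open Classical in
  if ∃ i, w₀ i = 0 ∧ w i ≠ 0 then ⊤ else Φ fun i => |w₀ i| ^ (α - 1) * |w i|

/-- The objective `½ ‖y - X w‖₂² + lam Φ(|w⁰|^{α-1} ∘ |w|)` of the adaptive estimator. -/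
def adaptiveObjective {d n : ℕ} (Φ : (Fin d → ℝ) → EReal) (α : ℝ) (lam : ℝ)
    (X : Matrix (Fin n) (Fin d) ℝ) (y : Fin n → ℝ) (w₀ w : Fin d → ℝ) : EReal :=
  ((1 / 2 * ∑ i, (y i - (X *ᵥ w) i) ^ 2 : ℝ) : EReal)
    + (lam : EReal) * adaptivePenalty Φ α w₀ w

/-- The fixed-dimension asymptotic regime for deterministic designs `X n ∈ ℝ^{n × d}`:
`X_nᵀ X_n / n → Q` with `Q` positive definite, where either the data accumulate
(`X n` consists of the first `n` rows of one fixed infinite matrix), or, for a general triangular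
array, no single observation dominates, `max_{i,j} (X n i j)² / n → 0`.
(In the first case the second condition holds automatically.) -/
structure IsAsymptoticDesign {d : ℕ} (X : ∀ n : ℕ, Matrix (Fin n) (Fin d) ℝ)
    (Q : Matrix (Fin d) (Fin d) ℝ) : Prop where
  posDef : Q.PosDef
  tendsto : Tendsto (fun n : ℕ => (n : ℝ)⁻¹ • ((X n)ᵀ * X n)) atTop (𝓝 Q)
  rows : (∃ x : ℕ → Fin d → ℝ, ∀ (n : ℕ) (i : Fin n) (j : Fin d), X n i j = x i j) ∨
    ∀ δ : ℝ, 0 < δ → ∀ᶠ n : ℕ in atTop, ∀ (i : Fin n) (j : Fin d), (X n i j) ^ 2 ≤ δ * n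

/-- `w n` is a `√n`-consistent estimator of `v`: `√n (w n - v) = O_P(1)`. -/
def IsSqrtConsistent {d : ℕ} {S : Type*} [MeasurableSpace S] (P : Measure S)
    (w : ℕ → S → Fin d → ℝ) (v : Fin d → ℝ) : Prop :=
  ∀ δ : ℝ≥0∞, 0 < δ → ∃ K : ℝ, ∀ᶠ n : ℕ in atTop,
    P {s | K < √(n : ℝ) * ‖w n s - v‖} ≤ δ

end

end CombPenalty

/-!
The estimator is analysed through two properties of the convex penalty `Φ`, collected in
`IsStablePenaltyAt`. Both are read off the affine minorants of the function `f` of which `Φ` is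
the convex envelope (`convexEnvelope_le_iff`).

* *Growth off `J`.* If `J` is strongly stable, the increments `F (A ∪ {i}) - F A` with `A ⊆ J`,
  `i ∉ J` are bounded below by some `η > 0`. Hölder's or Young's inequality turns this into
  `f w ≥ f w_J + c |w i|` with `c = η^{1/q}`. An affine minorant of `f` therefore remains one when it
  is made constant off `J` and given slope `± c` in the coordinate `i`, so the envelope inherits the
  inequality (`convexEnvelope_proj_add_le`).
* *A Lipschitz bound on `ℝ^J`.* The envelope is nonnegative, convex and bounded near
  `|w*|^{α-1} ∘ |w*|`, so there it exceeds its value at any other point of `ℝ^J` by at most a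
  multiple of the distance (`convexEnvelope_le_add_norm_sub`).

In the local parameter `u = √n (w - w*)` the loss is a quadratic `½ ⟨u, C u⟩ - ⟨g, u⟩`, up to a
constant, with `C → Q` and `g = n^{-1/2} Xᵀ ε` bounded in probability. The weights on `J` converge,
hence the penalty has Lipschitz constant of order `λ_n / √n → 0` there, whereas off `J` the weights
are at least of order `n^{(1-α)/2}`, so that the penalty has slope of order
`λ_n / n^{α/2} → ∞`. Comparing the estimator with the oracle point `Q_JJ⁻¹ g_J` shows that the two
differ by `o(1)`; comparing it with its own restriction to `J` then shows that it vanishes off `J`.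
Both comparisons are deterministic and uniform over the event that the noise term and the error of
the initial estimator are bounded by a constant (`eventually_estimator_bound`), so no
compactness or epi-convergence of random objective functions is involved.

It remains to prove that the oracle point is asymptotically normal. This is a central limit theorem
for weighted sums of i.i.d. variables (`tendstoInDistribution_of_weighted_sums`), obtained from
Lévy's convergence theorem and the second-order expansion of the characteristic function.
-/

namespace CombPenalty

/-! ### Restriction to a set of coordinates -/

/-- The restriction of a vector to the coordinates in `J`, with zeros elsewhere. -/
def proj {d : ℕ} (J : Finset (Fin d)) (w : Fin d → ℝ) : Fin d → ℝ :=
  fun i => if i ∈ J then w i else 0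

lemma proj_of_mem {d : ℕ} {J : Finset (Fin d)} {i : Fin d} (h : i ∈ J) (w : Fin d → ℝ) :
    proj J w i = w i := if_pos h

lemma proj_of_notMem {d : ℕ} {J : Finset (Fin d)} {i : Fin d} (h : i ∉ J) (w : Fin d → ℝ) :
    proj J w i = 0 := if_neg h

lemma proj_proj {d : ℕ} (J : Finset (Fin d)) (w : Fin d → ℝ) :
    proj J (proj J w) = proj J w := by
  ext i; simp only [proj]; split_ifs <;> rfl

lemma proj_dotProduct_comm {d : ℕ} (J : Finset (Fin d)) (v s : Fin d → ℝ) :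
    proj J v ⬝ᵥ s = v ⬝ᵥ proj J s := by
  simp only [dotProduct, proj]
  refine Finset.sum_congr rfl fun i _ => ?_
  split_ifs <;> simp

lemma mem_supp {d : ℕ} {w : Fin d → ℝ} {i : Fin d} : i ∈ supp w ↔ w i ≠ 0 := by
  simp [supp]

lemma supp_proj {d : ℕ} (J : Finset (Fin d)) (w : Fin d → ℝ) :
    supp (proj J w) = supp w ∩ J := by
  ext i; simp only [mem_supp, Finset.mem_inter, proj]; split_ifs <;> simp_all

/-! ### The convex envelope as a supremum of affine minorants -/

/-- The biconjugate at `v` is the supremum over the affine minorants `w ↦ ⟨w, s⟩ - a` of `f` of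
their values at `v`. -/
lemma convexEnvelope_le_iff {d : ℕ} {f : (Fin d → ℝ) → ℝ≥0∞} (hf0 : f 0 = 0)
    {v : Fin d → ℝ} {x : EReal} :
    convexEnvelope (fun w => (f w : EReal)) v ≤ x ↔
      ∀ (s : Fin d → ℝ) (a : ℝ), (∀ w, ((w ⬝ᵥ s - a : ℝ) : EReal) ≤ (f w : EReal)) →
        ((v ⬝ᵥ s - a : ℝ) : EReal) ≤ x := by
  -- `f* s ≤ a` says that `⟨·, s⟩ - a` is a minorant of `f`; and `f* ≥ 0` because `f 0 = 0`
  have key (s : Fin d → ℝ) (a : ℝ) : fenchelConj (fun w => (f w : EReal)) s ≤ (a : EReal) ↔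
      ∀ w, ((w ⬝ᵥ s - a : ℝ) : EReal) ≤ (f w : EReal) := by
    unfold fenchelConj
    rw [iSup_le_iff]
    refine forall_congr' fun w => ?_
    beta_reduce
    generalize f w = b
    cases b with
    | top => simp
    | coe b =>
      rw [← ENNReal.ofReal_coe_nnreal, EReal.coe_ennreal_ofReal, max_eq_left b.coe_nonneg,
        ← EReal.coe_sub, EReal.coe_le_coe_iff, EReal.coe_le_coe_iff]
      exact sub_le_comm
  constructor
  · intro h s a hs
    refine le_trans ?_ h
    have h1 : ((v ⬝ᵥ s : ℝ) : EReal) - fenchelConj (fun w => (f w : EReal)) s ≤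
        convexEnvelope (fun w => (f w : EReal)) v := by
      have := le_iSup (fun t : Fin d → ℝ => ((t ⬝ᵥ v : ℝ) : EReal)
        - fenchelConj (fun w => (f w : EReal)) t) s
      simpa [convexEnvelope, dotProduct_comm s v, fenchelConj] using this
    refine le_trans ?_ h1
    rw [EReal.coe_sub]
    exact EReal.sub_le_sub le_rfl ((key s a).2 hs)
  · intro h
    refine iSup_le fun s => ?_
    have hnn : (0 : EReal) ≤ fenchelConj (fun w => (f w : EReal)) s := by
      refine le_iSup_of_le 0 ?_
      simp [hf0]
    generalize hc : fenchelConj (fun w => (f w : EReal)) s = c at hnn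
    induction c with
    | bot => simp at hnn
    | top => simp
    | coe a =>
      rw [dotProduct_comm, ← EReal.coe_sub]
      exact h s a ((key s a).1 hc.le)

lemma le_convexEnvelope {d : ℕ} {f : (Fin d → ℝ) → ℝ≥0∞} (hf0 : f 0 = 0) {v s : Fin d → ℝ} {a : ℝ}
    (h : ∀ w, ((w ⬝ᵥ s - a : ℝ) : EReal) ≤ (f w : EReal)) :
    ((v ⬝ᵥ s - a : ℝ) : EReal) ≤ convexEnvelope (fun w => (f w : EReal)) v :=
  (convexEnvelope_le_iff hf0).1 le_rfl s a h

lemma convexEnvelope_le {d : ℕ} {f : (Fin d → ℝ) → ℝ≥0∞} (hf0 : f 0 = 0) (v : Fin d → ℝ) :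
    convexEnvelope (fun w => (f w : EReal)) v ≤ f v :=
  (convexEnvelope_le_iff hf0).2 fun _ _ h => h v

lemma convexEnvelope_nonneg {d : ℕ} {f : (Fin d → ℝ) → ℝ≥0∞} (hf0 : f 0 = 0) (v : Fin d → ℝ) :
    0 ≤ convexEnvelope (fun w => (f w : EReal)) v := by
  have := le_convexEnvelope hf0 (v := v) (s := 0) (a := 0) (by simp [EReal.coe_ennreal_nonneg])
  simpa using this

/-- Linear growth of `f` off `J` passes to its convex envelope: an affine minorant of `f`, made
constant in the coordinates off `J`, can be given the slope `± c` in a coordinate `i ∉ J`. -/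
lemma convexEnvelope_proj_add_le {d : ℕ} {f : (Fin d → ℝ) → ℝ≥0∞} (hf0 : f 0 = 0)
    {J : Finset (Fin d)} {c : ℝ} (hc : 0 ≤ c) {i : Fin d}
    (hf : ∀ w, f (proj J w) + ENNReal.ofReal (c * |w i|) ≤ f w) (v : Fin d → ℝ) :
    convexEnvelope (fun w => (f w : EReal)) (proj J v) + ((c * |v i| : ℝ) : EReal) ≤
      convexEnvelope (fun w => (f w : EReal)) v := by
  rw [← EReal.le_sub_iff_add_le (.inl (EReal.coe_ne_bot _)) (.inl (EReal.coe_ne_top _)),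
    convexEnvelope_le_iff hf0]
  intro s a hs
  rw [EReal.le_sub_iff_add_le (.inl (EReal.coe_ne_bot _)) (.inl (EReal.coe_ne_top _)),
    ← EReal.coe_add]
  -- the sign of `v i`, which makes `τ c` the slope that is steepest at `v`
  obtain ⟨τ, hτ, hτv⟩ : ∃ τ : ℝ, (∀ x : ℝ, τ * x ≤ |x|) ∧ τ * v i = |v i| := by
    rcases le_total 0 (v i) with h | h
    · exact ⟨1, fun x => by simpa using le_abs_self x, by simp [abs_of_nonneg h]⟩
    · exact ⟨-1, fun x => by simpa using neg_le_abs x, by simp [abs_of_nonpos h]⟩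
  have hdot (w : Fin d → ℝ) :
      w ⬝ᵥ (proj J s + Pi.single i (c * τ)) = proj J w ⬝ᵥ s + c * (τ * w i) := by
    rw [dotProduct_add, dotProduct_single, proj_dotProduct_comm]; ring
  have hmin := le_convexEnvelope hf0 (v := v) (s := proj J s + Pi.single i (c * τ)) (a := a) ?_
  · rw [hdot, hτv] at hmin
    convert hmin using 2
    ring
  · intro w
    rw [hdot]
    have h1 : (((f (proj J w) + ENNReal.ofReal (c * |w i|) : ℝ≥0∞)) : EReal) ≤ (f w : EReal) := by
      exact_mod_cast hf w
    refine le_trans ?_ h1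
    rw [EReal.coe_ennreal_add, EReal.coe_ennreal_ofReal, max_eq_left (by positivity)]
    refine le_trans ?_ (add_le_add_left (hs (proj J w)) _)
    norm_cast
    nlinarith [mul_le_mul_of_nonneg_left (hτ (w i)) hc]

/-- A nonnegative convex envelope that is bounded by `M` on the box of radius `2 r` around `v₀` in
`ℝ^J` satisfies a one-sided Lipschitz bound, with constant `M / r`, at the points of the box of
radius `r`, against arbitrary points of `ℝ^J`. -/
lemma convexEnvelope_le_add_norm_sub {d : ℕ} {f : (Fin d → ℝ) → ℝ≥0∞} (hf0 : f 0 = 0)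
    {J : Finset (Fin d)} {v₀ : Fin d → ℝ} {r M : ℝ} (hr : 0 < r) (hM : 0 ≤ M)
    (hbd : ∀ v, proj J v = v → ‖v - v₀‖ ≤ 2 * r →
      convexEnvelope (fun w => (f w : EReal)) v ≤ (M : EReal))
    {v v' : Fin d → ℝ} (hv : proj J v = v) (hv' : proj J v' = v') (hvr : ‖v - v₀‖ ≤ r) :
    convexEnvelope (fun w => (f w : EReal)) v ≤
      convexEnvelope (fun w => (f w : EReal)) v' + ((M / r * ‖v - v'‖ : ℝ) : EReal) := by
  rcases eq_or_ne v v' with rfl | hne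
  · simp
  set D := ‖v - v'‖ with hD
  have hDpos : 0 < D := norm_pos_iff.2 (sub_ne_zero.2 hne)
  have hnn := convexEnvelope_nonneg hf0 v'
  have hle := @le_convexEnvelope d f hf0 v'
  generalize convexEnvelope (fun w => (f w : EReal)) v' = y at hnn hle
  induction y with
  | bot => simp at hnn
  | top => rw [EReal.top_add_coe]; exact le_top
  | coe y =>
    have hy : 0 ≤ y := by exact_mod_cast hnn
    rw [convexEnvelope_le_iff hf0]
    intro s a hs
    have h1 : v' ⬝ᵥ s - a ≤ y := by exact_mod_cast hle hs
    -- the segment from `v'` to `v`, prolonged beyond `v` by the length `r`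
    have h2 : (v + (r / D) • (v - v')) ⬝ᵥ s - a ≤ M := by
      have hb := hbd (v + (r / D) • (v - v')) ?_ ?_
      · exact_mod_cast (le_convexEnvelope hf0 hs).trans hb
      · ext i
        have hvi := congrFun hv i
        have hvi' := congrFun hv' i
        simp only [proj, Pi.add_apply, Pi.smul_apply, Pi.sub_apply, smul_eq_mul] at *
        split_ifs at * <;> simp [← hvi, ← hvi']
      · calc ‖v + (r / D) • (v - v') - v₀‖ = ‖(v - v₀) + (r / D) • (v - v')‖ := by congr 1; abel
          _ ≤ ‖v - v₀‖ + ‖(r / D) • (v - v')‖ := norm_add_le _ _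
          _ = ‖v - v₀‖ + r := by
            rw [norm_smul, ← hD, Real.norm_of_nonneg (by positivity)]; field_simp
          _ ≤ 2 * r := by linarith
    rw [add_dotProduct, smul_dotProduct, sub_dotProduct, smul_eq_mul] at h2
    norm_cast
    by_contra! hcon
    have h3 : 0 < v ⬝ᵥ s - a := lt_of_le_of_lt (by positivity) hcon
    have h4 : M / r * D < v ⬝ᵥ s - v' ⬝ᵥ s := by linarith
    have h5 : M < r / D * (v ⬝ᵥ s - v' ⬝ᵥ s) := by
      calc M = r / D * (M / r * D) := by field_simp
        _ < _ := by gcongr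
    linarith

/-- Bounds on the multiples of the coordinate vectors give bounds for the convex envelope on a
box: `v` is the average of the `d` vectors `d v_i e_i`. -/
lemma convexEnvelope_le_of_single {d : ℕ} {f : (Fin d → ℝ) → ℝ≥0∞} (hf0 : f 0 = 0) {T M : ℝ}
    (hM : 0 ≤ M) (hf : ∀ i t, |t| ≤ T → f (Pi.single i t) ≤ ENNReal.ofReal M)
    {v : Fin d → ℝ} (hv : d * ‖v‖ ≤ T) :
    convexEnvelope (fun w => (f w : EReal)) v ≤ (M : EReal) := by
  rw [convexEnvelope_le_iff hf0]
  intro s a hs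
  norm_cast
  rcases Nat.eq_zero_or_pos d with rfl | hd
  · have h0 := hs 0
    rw [hf0, EReal.coe_ennreal_zero] at h0
    have h1 : (0 : Fin 0 → ℝ) ⬝ᵥ s - a ≤ 0 := by exact_mod_cast h0
    have : v = 0 := Subsingleton.elim _ _
    subst this
    linarith
  have hd' : (0 : ℝ) < d := by exact_mod_cast hd
  have h1 (i : Fin d) : d * (v i * s i) - a ≤ M := by
    have h2 : f (Pi.single i (d * v i)) ≤ ENNReal.ofReal M := by
      refine hf i _ (le_trans ?_ hv)
      rw [abs_mul, abs_of_pos hd']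
      gcongr
      exact norm_le_pi_norm v i
    have h3 : ((f (Pi.single i (d * v i)) : ℝ≥0∞) : EReal) ≤
        ((ENNReal.ofReal M : ℝ≥0∞) : EReal) := by
      exact_mod_cast h2
    have h4 := (hs (Pi.single i (d * v i))).trans h3
    rw [EReal.coe_ennreal_ofReal, max_eq_left hM] at h4
    have h5 : Pi.single i (d * v i) ⬝ᵥ s - a ≤ M := by exact_mod_cast h4
    rw [single_dotProduct] at h5
    linarith
  have h2 := Finset.sum_le_sum fun i (_ : i ∈ Finset.univ) => h1 i
  rw [Finset.sum_sub_distrib, ← Finset.mul_sum] at h2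
  simp only [Finset.sum_const, Finset.card_univ, Fintype.card_fin, nsmul_eq_mul] at h2
  have h3 : (d : ℝ) * (v ⬝ᵥ s - a) ≤ d * M := by
    simp only [dotProduct]; linarith
  exact le_of_mul_le_mul_left h3 hd'

/-! ### Growth off a strongly stable set, and local boundedness -/

/-- On a strongly stable set the increments of `F` are bounded below by a positive constant. -/
lemma IsStronglyStable.exists_gap {d : ℕ} {F : Finset (Fin d) → ℝ≥0∞} {J : Finset (Fin d)}
    (hF : IsCombPenalty F) (h : IsStronglyStable F J) :
    ∃ η : ℝ, 0 < η ∧ ∀ (w : Fin d → ℝ) (i : Fin d), i ∉ J → w i ≠ 0 →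
      F (supp (proj J w)) + ENNReal.ofReal η ≤ F (supp w) := by
  have h1 : ∀ᶠ η : ℝ in 𝓝[>] 0, ∀ A : Finset (Fin d), ∀ i : Fin d, A ⊆ J → i ∉ J →
      F A + ENNReal.ofReal η ≤ F (insert i A) := by
    refine eventually_all.2 fun A => eventually_all.2 fun i => ?_
    by_cases hA : A ⊆ J
    swap; · exact Eventually.of_forall fun _ h => absurd h hA
    by_cases hi : i ∈ J
    · exact Eventually.of_forall fun _ _ h => absurd hi h
    have ht : Tendsto (fun η : ℝ => F A + ENNReal.ofReal η) (𝓝[>] 0) (𝓝 (F A + ENNReal.ofReal 0)) :=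
      (((continuous_const_add (F A)).comp ENNReal.continuous_ofReal).tendsto 0).mono_left
        nhdsWithin_le_nhds
    rw [ENNReal.ofReal_zero, add_zero] at ht
    filter_upwards [ht.eventually_lt_const (h A hA i hi)] with η hη _ _ using hη.le
  obtain ⟨η, hη, hpos⟩ := (h1.and self_mem_nhdsWithin).exists
  refine ⟨η, hpos, fun w i hi hwi => ?_⟩
  rw [supp_proj]
  refine (hη _ i Finset.inter_subset_right hi).trans (hF.mono _ _ ?_)
  exact Finset.insert_subset (mem_supp.2 hwi) Finset.inter_subset_left

lemma supp_zero {d : ℕ} : supp (0 : Fin d → ℝ) = ∅ := by ext; simp [mem_supp]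

lemma homPenalty_zero {d : ℕ} (F : Finset (Fin d) → ℝ≥0∞) {p : ℝ≥0∞} (hp : 1 < p) :
    homPenalty F p 0 = 0 := by
  have : Fact (1 ≤ p) := ⟨hp.le⟩
  simp [homPenalty]

lemma lpPenalty_zero {d : ℕ} {F : Finset (Fin d) → ℝ≥0∞} (hF : IsCombPenalty F) {p : ℝ≥0∞}
    (hp : 1 < p) : lpPenalty F p 0 = 0 := by
  have : Fact (1 ≤ p) := ⟨hp.le⟩
  unfold lpPenalty
  split_ifs with h h2
  · simp [supp_zero, hF.empty]
  · simp at h2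
  · have : 0 < p.toReal := ENNReal.toReal_pos (by positivity) h
    simp [supp_zero, hF.empty, this.ne']

lemma norm_toLp_rpow {d : ℕ} {p : ℝ≥0∞} (hp : 1 < p) (hp' : p ≠ ∞) (w : Fin d → ℝ) :
    ‖WithLp.toLp p w‖ ^ p.toReal = ∑ i, |w i| ^ p.toReal := by
  have hpos : 0 < p.toReal := ENNReal.toReal_pos (zero_lt_one.trans hp).ne' hp'
  rw [PiLp.norm_eq_sum hpos, ← Real.rpow_mul (Finset.sum_nonneg fun _ _ => by positivity)]
  simp [hpos.ne']

lemma norm_toLp_proj_le {d : ℕ} {p : ℝ≥0∞} (hp : 1 < p) (J : Finset (Fin d)) (w : Fin d → ℝ) :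
    ‖WithLp.toLp p (proj J w)‖ ≤ ‖WithLp.toLp p w‖ := by
  rcases eq_or_ne p ∞ with rfl | hp'
  · rw [PiLp.norm_toLp, PiLp.norm_toLp]
    refine (pi_norm_le_iff_of_nonneg (norm_nonneg _)).2 fun i => ?_
    by_cases h : i ∈ J
    · rw [proj_of_mem h]; exact norm_le_pi_norm w i
    · rw [proj_of_notMem h]; simp
  · have : Fact (1 ≤ p) := ⟨hp.le⟩
    have hpos : 0 < p.toReal := ENNReal.toReal_pos (zero_lt_one.trans hp).ne' hp'
    rw [← Real.rpow_le_rpow_iff (norm_nonneg _) (norm_nonneg _) hpos, norm_toLp_rpow hp hp',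
      norm_toLp_rpow hp hp']
    refine Finset.sum_le_sum fun i _ => ?_
    by_cases h : i ∈ J
    · rw [proj_of_mem h]
    · rw [proj_of_notMem h, abs_zero, Real.zero_rpow hpos.ne']; positivity

lemma norm_toLp_proj_rpow_add_le {d : ℕ} {p : ℝ≥0∞} (hp : 1 < p) (hp' : p ≠ ∞)
    {J : Finset (Fin d)} (w : Fin d → ℝ) {i : Fin d} (hi : i ∉ J) :
    ‖WithLp.toLp p (proj J w)‖ ^ p.toReal + |w i| ^ p.toReal ≤ ‖WithLp.toLp p w‖ ^ p.toReal := by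
  have hpos : 0 < p.toReal := ENNReal.toReal_pos (zero_lt_one.trans hp).ne' hp'
  rw [norm_toLp_rpow hp hp', norm_toLp_rpow hp hp', ← Finset.sum_erase_add _ _ (Finset.mem_univ i),
    ← Finset.sum_erase_add (Finset.univ) (fun j => |w j| ^ p.toReal) (Finset.mem_univ i),
    proj_of_notMem hi, abs_zero, Real.zero_rpow hpos.ne', add_zero]
  gcongr ?_ + _
  refine Finset.sum_le_sum fun j _ => ?_
  gcongr ?_ ^ _
  simp only [proj]
  split_ifs <;> simp

/-- The increment of `F` at a coordinate off `J` makes the homogeneous penalty grow linearly, by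
Hölder's inequality. -/
lemma homPenalty_proj_add_le {d : ℕ} {F : Finset (Fin d) → ℝ≥0∞} (hF : IsCombPenalty F)
    {p : ℝ≥0∞} (hp : 1 < p) {J : Finset (Fin d)} {η : ℝ} (hη : 0 < η)
    (hgap : ∀ (w : Fin d → ℝ) (i : Fin d), i ∉ J → w i ≠ 0 →
      F (supp (proj J w)) + ENNReal.ofReal η ≤ F (supp w)) :
    ∃ c : ℝ, 0 < c ∧ ∀ i, i ∉ J → ∀ w,
      homPenalty F p (proj J w) + ENNReal.ofReal (c * |w i|) ≤ homPenalty F p w := by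
  have hconj := ENNReal.HolderConjugate.conjExponent hp.le
  set q := ENNReal.conjExponent p with hq
  have h00 (c : ℝ) (i : Fin d) (w : Fin d → ℝ) (h0 : w i = 0) :
      homPenalty F p (proj J w) + ENNReal.ofReal (c * |w i|) ≤ homPenalty F p w := by
    rw [h0, abs_zero, mul_zero, ENNReal.ofReal_zero, add_zero]
    unfold homPenalty
    gcongr
    · rw [supp_proj]; exact hF.mono _ _ Finset.inter_subset_left
    · exact norm_toLp_proj_le hp J w
  rcases eq_or_ne p ∞ with rfl | hp'
  · have hq1 : q = 1 := by simp [hq, ENNReal.conjExponent]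
    refine ⟨η, hη, fun i hi w => ?_⟩
    rcases eq_or_ne (w i) 0 with h0 | h0
    · exact h00 η i w h0
    unfold homPenalty
    rw [← hq, hq1]
    simp only [inv_one, ENNReal.toReal_one, ENNReal.rpow_one]
    calc _ ≤ F (supp (proj J w)) * ENNReal.ofReal ‖WithLp.toLp ∞ w‖
            + ENNReal.ofReal η * ENNReal.ofReal ‖WithLp.toLp ∞ w‖ := by
            rw [ENNReal.ofReal_mul hη.le]
            gcongr
            · exact norm_toLp_proj_le hp J w
            · rw [PiLp.norm_toLp]; exact norm_le_pi_norm w i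
      _ ≤ _ := by rw [← add_mul]; gcongr; exact hgap w i hi h0
  · have : Fact (1 ≤ p) := ⟨hp.le⟩
    have hpos : 0 < p.toReal := ENNReal.toReal_pos (zero_lt_one.trans hp).ne' hp'
    have hr : p.toReal.HolderConjugate q.toReal := hconj.toReal (by
      simpa using (ENNReal.toReal_lt_toReal ENNReal.one_ne_top hp').2 hp)
    refine ⟨η ^ (1 / q.toReal), by positivity, fun i hi w => ?_⟩
    rcases eq_or_ne (w i) 0 with h0 | h0
    · exact h00 _ i w h0
    unfold homPenalty
    rw [← hq, ENNReal.toReal_inv, ← one_div]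
    have hol := ENNReal.inner_le_Lp_mul_Lq (Finset.univ : Finset (Fin 2))
      ![F (supp (proj J w)) ^ (1 / q.toReal), ENNReal.ofReal η ^ (1 / q.toReal)]
      ![ENNReal.ofReal ‖WithLp.toLp p (proj J w)‖, ENNReal.ofReal |w i|] hr.symm
    simp only [Fin.sum_univ_two, Matrix.cons_val_zero, Matrix.cons_val_one, ← ENNReal.rpow_mul,
      one_div_mul_cancel hr.symm.ne_zero, ENNReal.rpow_one] at hol
    rw [ENNReal.ofReal_mul (by positivity), ← ENNReal.ofReal_rpow_of_pos hη]
    refine hol.trans ?_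
    gcongr
    · exact hgap w i hi h0
    · rw [one_div, ENNReal.rpow_inv_le_iff hpos,
        ENNReal.ofReal_rpow_of_nonneg (norm_nonneg _) hpos.le,
        ENNReal.ofReal_rpow_of_nonneg (abs_nonneg _) hpos.le,
        ENNReal.ofReal_rpow_of_nonneg (norm_nonneg _) hpos.le,
        ← ENNReal.ofReal_add (by positivity) (by positivity)]
      exact ENNReal.ofReal_le_ofReal (norm_toLp_proj_rpow_add_le hp hp' w hi)

/-- The increment of `F` at a coordinate off `J` makes the `ℓ_p`-regularized penalty grow linearly:
by Young's inequality for `p < ∞`, and because `|w i| ≤ 1` on the unit ball for `p = ∞`. -/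
lemma lpPenalty_proj_add_le {d : ℕ} {F : Finset (Fin d) → ℝ≥0∞} (hF : IsCombPenalty F)
    {p : ℝ≥0∞} (hp : 1 < p) {J : Finset (Fin d)} {η : ℝ} (hη : 0 < η)
    (hgap : ∀ (w : Fin d → ℝ) (i : Fin d), i ∉ J → w i ≠ 0 →
      F (supp (proj J w)) + ENNReal.ofReal η ≤ F (supp w)) :
    ∃ c : ℝ, 0 < c ∧ ∀ i, i ∉ J → ∀ w,
      lpPenalty F p (proj J w) + ENNReal.ofReal (c * |w i|) ≤ lpPenalty F p w := by
  have hconj := ENNReal.HolderConjugate.conjExponent hp.le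
  have hmono (w : Fin d → ℝ) : F (supp (proj J w)) ≤ F (supp w) := by
    rw [supp_proj]; exact hF.mono _ _ Finset.inter_subset_left
  rcases eq_or_ne p ∞ with rfl | hp'
  · refine ⟨η, hη, fun i hi w => ?_⟩
    simp only [lpPenalty, if_true]
    by_cases hw : ‖WithLp.toLp ∞ w‖ ≤ 1
    · rw [if_pos hw, if_pos ((norm_toLp_proj_le hp J w).trans hw), add_zero, add_zero]
      rcases eq_or_ne (w i) 0 with h0 | h0
      · rw [h0, abs_zero, mul_zero, ENNReal.ofReal_zero, add_zero]; exact hmono w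
      · refine le_trans ?_ (hgap w i hi h0)
        gcongr
        rw [PiLp.norm_toLp] at hw
        exact mul_le_of_le_one_right hη.le ((norm_le_pi_norm w i).trans hw)
    · rw [if_neg hw, add_top]; exact le_top
  · have : Fact (1 ≤ p) := ⟨hp.le⟩
    have hpos : 0 < p.toReal := ENNReal.toReal_pos (zero_lt_one.trans hp).ne' hp'
    have hr : p.toReal.HolderConjugate (ENNReal.conjExponent p).toReal := hconj.toReal (by
      simpa using (ENNReal.toReal_lt_toReal ENNReal.one_ne_top hp').2 hp)
    simp only [lpPenalty, if_neg hp']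
    have hq' : ENNReal.conjExponent p ≠ ∞ := fun h => hr.symm.ne_zero (by simp [h])
    set q := ENNReal.conjExponent p with hq
    refine ⟨η ^ (1 / q.toReal), by positivity, fun i hi w => ?_⟩
    have hnorm : ENNReal.ofReal (‖WithLp.toLp p (proj J w)‖ ^ p.toReal)
        + ENNReal.ofReal |w i| ^ p.toReal ≤ ENNReal.ofReal (‖WithLp.toLp p w‖ ^ p.toReal) := by
      rw [ENNReal.ofReal_rpow_of_nonneg (abs_nonneg _) hpos.le,
        ← ENNReal.ofReal_add (by positivity) (by positivity)]
      exact ENNReal.ofReal_le_ofReal (norm_toLp_proj_rpow_add_le hp hp' w hi)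
    rcases eq_or_ne (w i) 0 with h0 | h0
    · rw [h0, abs_zero, ENNReal.ofReal_zero, ENNReal.zero_rpow_of_pos hpos, add_zero] at hnorm
      rw [h0, abs_zero, mul_zero, ENNReal.ofReal_zero, add_zero]
      gcongr
      exact hmono w
    have hyoung := ENNReal.young_inequality (ENNReal.ofReal η ^ (1 / q.toReal))
      (ENNReal.ofReal |w i|) hr.symm
    rw [← ENNReal.rpow_mul, one_div_mul_cancel hr.symm.ne_zero, ENNReal.rpow_one,
      ENNReal.ofReal_toReal hq', ENNReal.ofReal_toReal hp', ENNReal.div_eq_inv_mul,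
      ENNReal.div_eq_inv_mul] at hyoung
    rw [ENNReal.ofReal_mul (by positivity), ← ENNReal.ofReal_rpow_of_pos hη]
    calc _ ≤ (q⁻¹ * F (supp (proj J w)) +
            p⁻¹ * ENNReal.ofReal (‖WithLp.toLp p (proj J w)‖ ^ p.toReal)) +
            (q⁻¹ * ENNReal.ofReal η + p⁻¹ * ENNReal.ofReal |w i| ^ p.toReal) := by gcongr
      _ = q⁻¹ * (F (supp (proj J w)) + ENNReal.ofReal η) +
            p⁻¹ * (ENNReal.ofReal (‖WithLp.toLp p (proj J w)‖ ^ p.toReal)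
              + ENNReal.ofReal |w i| ^ p.toReal) := by ring
      _ ≤ _ := by gcongr; exact hgap w i hi h0

lemma IsCombPenalty.singleton_lt_top {d : ℕ} {F : Finset (Fin d) → ℝ≥0∞} (hF : IsCombPenalty F)
    (i : Fin d) : F {i} < ∞ := by
  obtain ⟨A, hi, hA⟩ := hF.cover i
  exact (hF.mono _ _ (Finset.singleton_subset_iff.2 hi)).trans_lt hA

/-- A common finite bound for the values of `F` on singletons. -/
lemma IsCombPenalty.exists_bound {d : ℕ} {F : Finset (Fin d) → ℝ≥0∞} (hF : IsCombPenalty F) :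
    ∃ B : ℝ≥0∞, B ≠ ∞ ∧ ∀ (i : Fin d) (t : ℝ), F (supp (Pi.single i t)) ≤ B := by
  refine ⟨∑ i, F {i}, (ENNReal.sum_lt_top.2 fun i _ => hF.singleton_lt_top i).ne, fun i t => ?_⟩
  refine (hF.mono _ {i} fun j hj => ?_).trans
    (Finset.single_le_sum (f := fun i => F {i}) (fun _ _ => zero_le) (Finset.mem_univ i))
  rw [mem_supp] at hj
  by_contra h
  exact hj (Pi.single_eq_of_ne (by simpa using h) _)

lemma homPenalty_single_le {d : ℕ} {F : Finset (Fin d) → ℝ≥0∞} (hF : IsCombPenalty F)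
    {p : ℝ≥0∞} (hp : 1 < p) (T : ℝ) :
    ∃ M : ℝ, 0 ≤ M ∧ ∀ i t, |t| ≤ T → homPenalty F p (Pi.single i t) ≤ ENNReal.ofReal M := by
  have : Fact (1 ≤ p) := ⟨hp.le⟩
  obtain ⟨B, hB, hFB⟩ := hF.exists_bound
  have hfin : B ^ ((ENNReal.conjExponent p)⁻¹).toReal * ENNReal.ofReal T ≠ ∞ :=
    ENNReal.mul_ne_top (ENNReal.rpow_ne_top_of_nonneg ENNReal.toReal_nonneg hB)
      ENNReal.ofReal_ne_top
  refine ⟨_, ENNReal.toReal_nonneg (a := B ^ ((ENNReal.conjExponent p)⁻¹).toReal *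
    ENNReal.ofReal T), fun i t ht => ?_⟩
  rw [ENNReal.ofReal_toReal hfin]
  unfold homPenalty
  gcongr
  · exact hFB i t
  · exact (PiLp.norm_single p (fun _ => ℝ) i t).trans_le ht

lemma lpPenalty_single_le {d : ℕ} {F : Finset (Fin d) → ℝ≥0∞} (hF : IsCombPenalty F)
    {p : ℝ≥0∞} (hp : 1 < p) (hp' : p ≠ ∞) (T : ℝ) :
    ∃ M : ℝ, 0 ≤ M ∧ ∀ i t, |t| ≤ T → lpPenalty F p (Pi.single i t) ≤ ENNReal.ofReal M := by
  have : Fact (1 ≤ p) := ⟨hp.le⟩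
  obtain ⟨B, hB, hFB⟩ := hF.exists_bound
  have hfin : (ENNReal.conjExponent p)⁻¹ * B + p⁻¹ * ENNReal.ofReal (T ^ p.toReal) ≠ ∞ := by
    have h1 : (ENNReal.conjExponent p)⁻¹ ≠ ∞ := by simp [ENNReal.conjExponent]
    have h2 : p⁻¹ ≠ ∞ := by simpa using (zero_lt_one.trans hp).ne'
    finiteness
  refine ⟨_, ENNReal.toReal_nonneg (a := (ENNReal.conjExponent p)⁻¹ * B +
    p⁻¹ * ENNReal.ofReal (T ^ p.toReal)), fun i t ht => ?_⟩
  rw [ENNReal.ofReal_toReal hfin]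
  simp only [lpPenalty, if_neg hp']
  gcongr
  · exact hFB i t
  · exact (PiLp.norm_single p (fun _ => ℝ) i t).trans_le ht

/-- The three properties of the convex penalties that the asymptotic analysis uses: nonnegativity,
linear growth in the coordinates off `J` (the convex form of strong stability), and a one-sided
Lipschitz bound on `ℝ^J` near `v₀`. -/
structure IsStablePenaltyAt {d : ℕ} (Φ : (Fin d → ℝ) → EReal) (J : Finset (Fin d))
    (v₀ : Fin d → ℝ) (c r L : ℝ) : Prop where
  c_pos : 0 < c
  r_pos : 0 < r
  L_nonneg : 0 ≤ L
  nonneg : ∀ v, 0 ≤ Φ v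
  growth : ∀ i, i ∉ J → ∀ v, Φ (proj J v) + ((c * |v i| : ℝ) : EReal) ≤ Φ v
  ne_top : ∀ v, proj J v = v → ‖v - v₀‖ ≤ r → Φ v ≠ ⊤
  lipschitz : ∀ v v', proj J v = v → proj J v' = v' → ‖v - v₀‖ ≤ r →
    Φ v ≤ Φ v' + ((L * ‖v - v'‖ : ℝ) : EReal)

lemma isStablePenaltyAt_convexEnvelope {d : ℕ} {f : (Fin d → ℝ) → ℝ≥0∞} (hf0 : f 0 = 0)
    {J : Finset (Fin d)}
    (hgrow : ∃ c : ℝ, 0 < c ∧ ∀ i, i ∉ J → ∀ w,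
      f (proj J w) + ENNReal.ofReal (c * |w i|) ≤ f w)
    {v₀ : Fin d → ℝ} {r M : ℝ} (hr : 0 < r) (hM : 0 ≤ M)
    (hbd : ∀ v, proj J v = v → ‖v - v₀‖ ≤ 2 * r →
      convexEnvelope (fun w => (f w : EReal)) v ≤ (M : EReal)) :
    ∃ c r L, IsStablePenaltyAt (convexEnvelope fun w => (f w : EReal)) J v₀ c r L := by
  obtain ⟨c, hc, hcf⟩ := hgrow
  exact ⟨c, r, M / r, hc, hr, by positivity, convexEnvelope_nonneg hf0,
    fun i hi v => convexEnvelope_proj_add_le hf0 hc.le (hcf i hi) v,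
    fun v hv hvr => ((hbd v hv (by linarith)).trans_lt (EReal.coe_lt_top M)).ne,
    fun v v' hv hv' hvr => convexEnvelope_le_add_norm_sub hf0 hr hM hbd hv hv' hvr⟩

/-- Bounds along the coordinate axes suffice, whatever the centre `v₀`. -/
lemma isStablePenaltyAt_of_single {d : ℕ} {f : (Fin d → ℝ) → ℝ≥0∞} (hf0 : f 0 = 0)
    {J : Finset (Fin d)}
    (hgrow : ∃ c : ℝ, 0 < c ∧ ∀ i, i ∉ J → ∀ w,
      f (proj J w) + ENNReal.ofReal (c * |w i|) ≤ f w)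
    (hsingle : ∀ T, ∃ M : ℝ, 0 ≤ M ∧ ∀ i t, |t| ≤ T → f (Pi.single i t) ≤ ENNReal.ofReal M)
    (v₀ : Fin d → ℝ) :
    ∃ c r L, IsStablePenaltyAt (convexEnvelope fun w => (f w : EReal)) J v₀ c r L := by
  obtain ⟨M, hM, hf⟩ := hsingle (d * (2 * 1 + ‖v₀‖))
  refine isStablePenaltyAt_convexEnvelope hf0 hgrow one_pos hM fun v _ hv => ?_
  refine convexEnvelope_le_of_single hf0 hM hf ?_
  gcongr
  calc ‖v‖ = ‖(v - v₀) + v₀‖ := by rw [sub_add_cancel]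
    _ ≤ _ := (norm_add_le _ _).trans (by gcongr)

/-- Both convex envelopes are stable penalties at every vector supported on a strongly stable set
`J`. For the envelope of `F + ι_{‖·‖_∞ ≤ 1}` the vector has to lie in the interior of the unit cube
and `F J` has to be finite. -/
lemma exists_isStablePenaltyAt {d : ℕ} {F : Finset (Fin d) → ℝ≥0∞} (hF : IsCombPenalty F)
    {p : ℝ≥0∞} (hp : 1 < p) {Φ : (Fin d → ℝ) → EReal} (hΦ : Φ = omegaEnv F p ∨ Φ = thetaEnv F p)
    {J : Finset (Fin d)} (hJ : IsStronglyStable F J) (v₀ : Fin d → ℝ)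
    (hbound : p = ∞ → ∀ i, |v₀ i| < 1) (hfeas : p = ∞ → Φ = thetaEnv F p → F J < ∞) :
    ∃ c r L, IsStablePenaltyAt Φ J v₀ c r L := by
  obtain ⟨η, hη, hgap⟩ := hJ.exists_gap hF
  by_cases hΘ : Φ = thetaEnv F p
  swap
  · obtain rfl := hΦ.resolve_right hΘ
    exact isStablePenaltyAt_of_single (homPenalty_zero F hp) (homPenalty_proj_add_le hF hp hη hgap)
      (homPenalty_single_le hF hp) v₀
  by_cases hp' : p = ∞
  swap
  · subst hΘ
    exact isStablePenaltyAt_of_single (lpPenalty_zero hF hp) (lpPenalty_proj_add_le hF hp hη hgap)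
      (lpPenalty_single_le hF hp hp') v₀
  -- for `F + ι_{‖·‖_∞ ≤ 1}` the bound on the unit cube of `ℝ^J` is `F J`
  have hFJ := hfeas hp' hΘ
  subst hΘ
  have hv₀ : ‖v₀‖ < 1 := (pi_norm_lt_iff one_pos).2 (hbound hp')
  refine isStablePenaltyAt_convexEnvelope (r := (1 - ‖v₀‖) / 2) (M := (F J).toReal)
    (lpPenalty_zero hF hp) (lpPenalty_proj_add_le hF hp hη hgap) (by linarith)
    ENNReal.toReal_nonneg fun v hv hvr => ?_
  refine (convexEnvelope_le (lpPenalty_zero hF hp) v).trans ?_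
  have hv1 : ‖v‖ ≤ 1 := by
    calc ‖v‖ = ‖(v - v₀) + v₀‖ := by rw [sub_add_cancel]
      _ ≤ ‖v - v₀‖ + ‖v₀‖ := norm_add_le _ _
      _ ≤ 1 := by linarith
  have h1 : lpPenalty F p v ≤ F J := by
    subst hp'
    rw [lpPenalty, if_pos rfl, if_pos (by rwa [PiLp.norm_toLp]), add_zero, ← hv, supp_proj]
    exact hF.mono _ _ Finset.inter_subset_right
  rw [EReal.coe_ennreal_toReal hFJ.ne]
  exact_mod_cast h1

/-! ### Perturbed quadratic minimization -/

/-- The quadratic function `u ↦ ½ ⟨u, C u⟩ - ⟨g, u⟩`, which is the least-squares loss in the local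
parameter `u = √n (w - w*)` up to a constant. -/
noncomputable def quad {d : ℕ} (C : Matrix (Fin d) (Fin d) ℝ) (g u : Fin d → ℝ) : ℝ :=
  1 / 2 * (u ⬝ᵥ C *ᵥ u) - g ⬝ᵥ u

lemma quad_sub_quad {d : ℕ} {C : Matrix (Fin d) (Fin d) ℝ} (hC : Cᵀ = C) (g u v : Fin d → ℝ) :
    quad C g u - quad C g v =
      1 / 2 * ((u - v) ⬝ᵥ C *ᵥ (u - v)) + (C *ᵥ v - g) ⬝ᵥ (u - v) := by
  have h : u ⬝ᵥ C *ᵥ v = v ⬝ᵥ C *ᵥ u := by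
    rw [Matrix.dotProduct_mulVec, ← Matrix.mulVec_transpose, hC, dotProduct_comm]
  simp only [quad, Matrix.mulVec_sub, sub_dotProduct, dotProduct_sub]
  rw [h, dotProduct_comm (C *ᵥ v) u, dotProduct_comm (C *ᵥ v) v, h]
  ring

/-- An inner product is at most `B` if each of its `d` terms is at most `B / d`; multiplied out to
cover `d = 0`. -/
lemma abs_dotProduct_le {d : ℕ} {x y : Fin d → ℝ} {B : ℝ} (h : ∀ i, d * |x i * y i| ≤ B)
    (hB : 0 ≤ B) : |x ⬝ᵥ y| ≤ B := by
  rcases Nat.eq_zero_or_pos d with rfl | hd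
  · simpa [dotProduct] using hB
  have hd' : (0 : ℝ) < d := by exact_mod_cast hd
  have h1 : (d : ℝ) * |x ⬝ᵥ y| ≤ d * B := by
    calc (d : ℝ) * |x ⬝ᵥ y| ≤ d * ∑ i, |x i * y i| := by
          gcongr; exact Finset.abs_sum_le_sum_abs _ _
      _ = ∑ i, d * |x i * y i| := Finset.mul_sum _ _ _
      _ ≤ ∑ _i : Fin d, B := Finset.sum_le_sum fun i _ => h i
      _ = d * B := by simp
  exact le_of_mul_le_mul_left h1 hd'

/-- A point `u` that does at least as well as `t` for the quadratic plus a penalty, where `t` is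
nearly stationary in the coordinates of `J` and the penalty grows fast off `J`, is close to `t`. -/
lemma norm_sub_le_of_quad_add_le {d : ℕ} {C : Matrix (Fin d) (Fin d) ℝ} (hC : Cᵀ = C)
    {J : Finset (Fin d)} {g u t : Fin d → ℝ} {μ ρ R m τ Δ : ℝ} (hμ : 0 < μ)
    (hpos : ∀ v : Fin d → ℝ, μ * ‖v‖ ^ 2 ≤ v ⬝ᵥ C *ᵥ v) (ht : proj J t = t)
    (hρ0 : 0 ≤ ρ) (hτ0 : 0 ≤ τ) (hρ : ∀ j ∈ J, |(C *ᵥ t - g) j| ≤ ρ)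
    (hR : ∀ i, |(C *ᵥ t - g) i| ≤ R) (hm : d * R ≤ m)
    (hmin : quad C g u - quad C g t + Δ ≤ 0)
    (hΔ : -(τ * ‖u - t‖) ≤ Δ) (hΔ' : ∀ i, i ∉ J → m * |u i| - τ * ‖u - t‖ ≤ Δ) :
    ‖u - t‖ ≤ 2 * (d * ρ + τ) / μ := by
  set D := ‖u - t‖ with hD
  have hD0 : 0 ≤ D := norm_nonneg _
  have h1 : |(C *ᵥ t - g) ⬝ᵥ (u - t)| ≤ d * ρ * D + (Δ + τ * D) := by
    refine abs_dotProduct_le (fun i => ?_) ?_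
    · by_cases hi : i ∈ J
      · have h2 : |(u - t) i| ≤ D := norm_le_pi_norm (u - t) i
        have h3 : |(C *ᵥ t - g) i * (u - t) i| ≤ ρ * D := by
          rw [abs_mul]; exact mul_le_mul (hρ i hi) h2 (abs_nonneg _) hρ0
        have : (d : ℝ) * |(C *ᵥ t - g) i * (u - t) i| ≤ d * (ρ * D) := by gcongr
        linarith
      · have hti : t i = 0 := by rw [← ht]; exact proj_of_notMem hi t
        have h2 : (d : ℝ) * |(C *ᵥ t - g) i * (u - t) i| ≤ m * |u i| := by
          rw [abs_mul, Pi.sub_apply u t, hti, sub_zero, ← mul_assoc]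
          exact mul_le_mul_of_nonneg_right
            ((mul_le_mul_of_nonneg_left (hR i) (Nat.cast_nonneg d)).trans hm) (abs_nonneg _)
        have := hΔ' i hi
        have : 0 ≤ d * ρ * D := by positivity
        linarith
    · have : 0 ≤ d * ρ * D := by positivity
      linarith
  have h2 := hpos (u - t)
  rw [quad_sub_quad hC] at hmin
  have h3 := (abs_le.1 h1).1
  have h4 : μ * D ^ 2 ≤ 2 * (d * ρ + τ) * D := by linarith
  rw [le_div_iff₀ hμ]
  rcases hD0.eq_or_lt with h0 | h0
  · rw [← h0, zero_mul]; positivity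
  · have : D * μ * D ≤ 2 * (d * ρ + τ) * D := by linarith
    exact le_of_mul_le_mul_right this h0

/-- A point `u` that does at least as well as its restriction to `J`, for a penalty that grows off
`J` faster than the quadratic can decrease, is supported on `J`. -/
lemma eq_zero_of_quad_add_le {d : ℕ} {C : Matrix (Fin d) (Fin d) ℝ} (hC : Cᵀ = C)
    {J : Finset (Fin d)} {g u : Fin d → ℝ} {R m Δ : ℝ}
    (hpos : ∀ v : Fin d → ℝ, 0 ≤ v ⬝ᵥ C *ᵥ v)
    (hR0 : 0 ≤ R) (hR : ∀ i, |(C *ᵥ proj J u - g) i| ≤ R) (hm : d * R < m)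
    (hmin : quad C g u - quad C g (proj J u) + Δ ≤ 0)
    (hΔ : 0 ≤ Δ) (hΔ' : ∀ i, i ∉ J → m * |u i| ≤ Δ) {i : Fin d} (hi : i ∉ J) : u i = 0 := by
  have hm0 : 0 < m := lt_of_le_of_lt (by positivity) hm
  have h1 : |(C *ᵥ proj J u - g) ⬝ᵥ (u - proj J u)| ≤ d * R / m * Δ := by
    refine abs_dotProduct_le (fun i => ?_) (by positivity)
    by_cases hi : i ∈ J
    · rw [Pi.sub_apply u, proj_of_mem hi, sub_self, mul_zero, abs_zero, mul_zero]
      positivity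
    · rw [abs_mul, Pi.sub_apply u, proj_of_notMem hi, sub_zero]
      calc (d : ℝ) * (|(C *ᵥ proj J u - g) i| * |u i|) ≤ d * (R * |u i|) := by gcongr; exact hR i
        _ = d * R / m * (m * |u i|) := by field_simp
        _ ≤ _ := by gcongr; exact hΔ' i hi
  rw [quad_sub_quad hC] at hmin
  have h2 := hpos (u - proj J u)
  have h3 := (abs_le.1 h1).1
  have h4 : d * R / m < 1 := (div_lt_one hm0).2 hm
  have h5 : Δ = 0 := by
    by_contra hne
    have : 0 < Δ := lt_of_le_of_ne hΔ (Ne.symm hne)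
    have : d * R / m * Δ < Δ := mul_lt_of_lt_one_left this h4
    linarith
  have h6 := hΔ' i hi
  rw [h5] at h6
  have h7 : |u i| ≤ 0 := by
    by_contra! hne
    have := mul_pos hm0 hne
    linarith
  exact abs_nonpos_iff.1 h7

/-! ### The estimator for a single sample size -/

/-- The residual sum of squares in the local parameter. -/
lemma half_sum_sq_residual {d n : ℕ} (hn : 0 < n) (X : Matrix (Fin n) (Fin d) ℝ)
    (wstar w : Fin d → ℝ) (e : Fin n → ℝ) :
    1 / 2 * ∑ i, (((X *ᵥ wstar) i + e i) - (X *ᵥ w) i) ^ 2 =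
      1 / 2 * (e ⬝ᵥ e) + quad ((n : ℝ)⁻¹ • (Xᵀ * X)) ((√(n : ℝ))⁻¹ • (Xᵀ *ᵥ e))
        (√(n : ℝ) • (w - wstar)) := by
  have hs : √(n : ℝ) ≠ 0 := by positivity
  have hs2 : (n : ℝ)⁻¹ * (√(n : ℝ) * √(n : ℝ)) = 1 := by
    rw [Real.mul_self_sqrt (Nat.cast_nonneg n)]
    exact inv_mul_cancel₀ (by positivity)
  set z := X *ᵥ (w - wstar) with hz
  have h1 : ∑ i, (((X *ᵥ wstar) i + e i) - (X *ᵥ w) i) ^ 2 = (e - z) ⬝ᵥ (e - z) := by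
    simp only [dotProduct, hz, Matrix.mulVec_sub, Pi.sub_apply]
    exact Finset.sum_congr rfl fun i _ => by ring
  have h2 : (w - wstar) ⬝ᵥ (Xᵀ * X) *ᵥ (w - wstar) = z ⬝ᵥ z := by
    rw [← Matrix.mulVec_mulVec, Matrix.dotProduct_mulVec, ← Matrix.mulVec_transpose,
      Matrix.transpose_transpose]
  have h3 : (Xᵀ *ᵥ e) ⬝ᵥ (w - wstar) = e ⬝ᵥ z := by
    rw [Matrix.mulVec_transpose, ← Matrix.dotProduct_mulVec]
  have h4 : (e - z) ⬝ᵥ (e - z) = e ⬝ᵥ e - 2 * (e ⬝ᵥ z) + z ⬝ᵥ z := by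
    rw [sub_dotProduct, dotProduct_sub, dotProduct_sub, dotProduct_comm z e]; ring
  rw [h1, h4]
  simp only [quad, Matrix.smul_mulVec, Matrix.mulVec_smul, dotProduct_smul, smul_dotProduct,
    smul_eq_mul, h2, h3]
  have h5 : √(n : ℝ) * ((n : ℝ)⁻¹ * (√(n : ℝ) * (z ⬝ᵥ z))) = z ⬝ᵥ z := by
    linear_combination (z ⬝ᵥ z) * hs2
  have h6 : √(n : ℝ) * ((√(n : ℝ))⁻¹ * (e ⬝ᵥ z)) = e ⬝ᵥ z := by field_simp
  rw [h5, h6]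
  ring

lemma IsStablePenaltyAt.proj_le {d : ℕ} {Φ : (Fin d → ℝ) → EReal} {J : Finset (Fin d)}
    {v₀ : Fin d → ℝ} {c r L : ℝ} (h : IsStablePenaltyAt Φ J v₀ c r L) (v : Fin d → ℝ) :
    Φ (proj J v) ≤ Φ v := by
  by_cases hJ : ∃ i, i ∉ J
  · obtain ⟨i, hi⟩ := hJ
    refine le_trans ?_ (h.growth i hi v)
    exact le_add_of_nonneg_right (by exact_mod_cast mul_nonneg h.c_pos.le (abs_nonneg _))
  · push Not at hJ
    have : proj J v = v := by ext i; exact proj_of_mem (hJ i) v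
    rw [this]

/-- The argument `|w₀|^{α-1} ∘ |w|` of the adaptive penalty. -/
noncomputable def weighted {d : ℕ} (α : ℝ) (w₀ w : Fin d → ℝ) : Fin d → ℝ :=
  fun i => |w₀ i| ^ (α - 1) * |w i|

lemma weighted_proj {d : ℕ} (α : ℝ) (w₀ w : Fin d → ℝ) (J : Finset (Fin d)) :
    weighted α w₀ (proj J w) = proj J (weighted α w₀ w) := by
  ext i; simp only [weighted, proj]; split_ifs <;> simp

lemma adaptiveObjective_eq {d n : ℕ} {Φ : (Fin d → ℝ) → EReal} {α lam : ℝ}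
    {X : Matrix (Fin n) (Fin d) ℝ} {y : Fin n → ℝ} {w₀ w : Fin d → ℝ}
    (hw : ∀ i, w₀ i = 0 → w i = 0) :
    adaptiveObjective Φ α lam X y w₀ w =
      ((1 / 2 * ∑ i, (y i - (X *ᵥ w) i) ^ 2 : ℝ) : EReal)
        + (lam : EReal) * Φ (weighted α w₀ w) := by
  rw [adaptiveObjective, adaptivePenalty, if_neg]
  · rfl
  · rintro ⟨i, h1, h2⟩; exact h2 (hw i h1)

lemma adaptiveObjective_eq_top {d n : ℕ} {Φ : (Fin d → ℝ) → EReal} {α lam : ℝ} (hlam : 0 < lam)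
    {X : Matrix (Fin n) (Fin d) ℝ} {y : Fin n → ℝ} {w₀ w : Fin d → ℝ}
    (hw : adaptivePenalty Φ α w₀ w = ⊤) : adaptiveObjective Φ α lam X y w₀ w = ⊤ := by
  rw [adaptiveObjective, hw, EReal.coe_mul_top_of_pos hlam, EReal.coe_add_top]

/-- Deterministic error bound and support recovery for the adaptive estimator `w`. The vector `t`
is the local parameter of an approximate solution supported on `J`; the gradient of the quadratic at
`t` is at most `ρ` on `J` and at most `R` everywhere. The weights are at most `Wmax` on `J` and at
least `ω` off `J`, so that in the local parameter the scaled penalty has Lipschitz constant `τ` on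
`ℝ^J` and slope `m` off `J`. -/
theorem estimator_bound {d n : ℕ} (hn : 0 < n) {Φ : (Fin d → ℝ) → EReal} {J : Finset (Fin d)}
    {v₀ : Fin d → ℝ} {c r L : ℝ} (hΦ : IsStablePenaltyAt Φ J v₀ c r L)
    {wstar : Fin d → ℝ} (hJ : proj J wstar = wstar) {α lam : ℝ} (hlam : 0 < lam)
    {X : Matrix (Fin n) (Fin d) ℝ} {e : Fin n → ℝ} {w₀ w t : Fin d → ℝ}
    (hmin : ∀ w', adaptiveObjective Φ α lam X (fun i => (X *ᵥ wstar) i + e i) w₀ w ≤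
      adaptiveObjective Φ α lam X (fun i => (X *ᵥ wstar) i + e i) w₀ w')
    {Wmax ω : ℝ} (hW0 : ∀ j ∈ J, w₀ j ≠ 0) (hWmax : ∀ j ∈ J, |w₀ j| ^ (α - 1) ≤ Wmax)
    (hWmax0 : 0 ≤ Wmax)
    (hω : ∀ i, i ∉ J → w₀ i ≠ 0 → ω ≤ |w₀ i| ^ (α - 1))
    (ht : proj J t = t)
    (htr : ‖weighted α w₀ (wstar + (√(n : ℝ))⁻¹ • t) - v₀‖ ≤ r)
    {C : Matrix (Fin d) (Fin d) ℝ} (hC : C = (n : ℝ)⁻¹ • (Xᵀ * X))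
    {g : Fin d → ℝ} (hg : g = (√(n : ℝ))⁻¹ • (Xᵀ *ᵥ e))
    {μ ρ R m τ b : ℝ} (hμ : 0 < μ)
    (hpos : ∀ v : Fin d → ℝ, μ * ‖v‖ ^ 2 ≤ v ⬝ᵥ C *ᵥ v)
    (hCb : ∀ i j, |C i j| ≤ b) (hb : 0 ≤ b)
    (hρ0 : 0 ≤ ρ) (hρ : ∀ j ∈ J, |(C *ᵥ t - g) j| ≤ ρ)
    (hR0 : 0 ≤ R) (hR : ∀ i, |(C *ᵥ t - g) i| ≤ R)
    (hτ : τ = lam * (L * (Wmax / √(n : ℝ)))) (hmdef : m = lam * (c * (ω / √(n : ℝ))))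
    (hm : d * (R + d * b * (2 * (d * ρ + τ) / μ)) < m) :
    ‖√(n : ℝ) • (w - wstar) - t‖ ≤ 2 * (d * ρ + τ) / μ ∧ ∀ i, i ∉ J → w i = 0 := by
  have hs : 0 < √(n : ℝ) := by positivity
  set s := √(n : ℝ) with hsdef
  set u := s • (w - wstar) with hu
  have hw : w = wstar + s⁻¹ • u := by
    rw [hu, smul_smul, inv_mul_cancel₀ hs.ne', one_smul]; abel
  set wt := wstar + s⁻¹ • t with hwt
  have hut : s • (wt - wstar) = t := by
    rw [hwt, add_sub_cancel_left, smul_smul, mul_inv_cancel₀ hs.ne', one_smul]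
  have hzero {w' : Fin d → ℝ} (h : proj J w' = w') (i : Fin d) (hi : w₀ i = 0) : w' i = 0 := by
    rw [← h]; exact proj_of_notMem (fun hj => hW0 i hj hi) w'
  have hwtJ : proj J wt = wt := by
    ext i
    have h1 := congrFun hJ i
    have h2 := congrFun ht i
    simp only [proj, hwt, Pi.add_apply, Pi.smul_apply, smul_eq_mul] at *
    split_ifs at * <;> simp [← h1, ← h2]
  -- all the penalties involved are finite
  obtain ⟨B, hB⟩ : ∃ B : ℝ, Φ (weighted α w₀ wt) = (B : EReal) := by
    have h1 := hΦ.ne_top (weighted α w₀ wt) (by rw [← weighted_proj, hwtJ]) htr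
    have h2 := hΦ.nonneg (weighted α w₀ wt)
    exact ⟨_, (EReal.coe_toReal h1 (ne_of_gt (lt_of_lt_of_le EReal.bot_lt_zero h2))).symm⟩
  have hloss (w' : Fin d → ℝ) := half_sum_sq_residual hn X wstar w' e
  rw [← hsdef, ← hC, ← hg] at hloss
  have hmin1 := hmin wt
  rw [adaptiveObjective_eq (hzero hwtJ), hB, hloss, hut] at hmin1
  have hpen : adaptivePenalty Φ α w₀ w ≠ ⊤ := by
    intro h
    rw [adaptiveObjective_eq_top hlam h, ← EReal.coe_mul, ← EReal.coe_add] at hmin1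
    exact absurd (top_le_iff.1 hmin1) (EReal.coe_ne_top _)
  -- an infinite weight forces the coordinate to vanish
  have hw0 : ∀ i, w₀ i = 0 → w i = 0 := by
    intro i hi
    by_contra hne
    exact hpen (by rw [adaptivePenalty, if_pos ⟨i, hi, hne⟩])
  obtain ⟨A, hA⟩ : ∃ A : ℝ, Φ (weighted α w₀ w) = (A : EReal) := by
    have h1 : Φ (weighted α w₀ w) ≠ ⊤ := by
      rw [adaptivePenalty, if_neg] at hpen
      · exact hpen
      · rintro ⟨i, h1, h2⟩; exact h2 (hw0 i h1)
    have h2 := hΦ.nonneg (weighted α w₀ w)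
    exact ⟨_, (EReal.coe_toReal h1 (ne_of_gt (lt_of_lt_of_le EReal.bot_lt_zero h2))).symm⟩
  have hAJle := hΦ.proj_le (weighted α w₀ w)
  obtain ⟨AJ, hAJ⟩ : ∃ A : ℝ, Φ (proj J (weighted α w₀ w)) = (A : EReal) := by
    have h1 : Φ (proj J (weighted α w₀ w)) ≠ ⊤ :=
      (hAJle.trans_lt (hA ▸ EReal.coe_lt_top A)).ne
    have h2 := hΦ.nonneg (proj J (weighted α w₀ w))
    exact ⟨_, (EReal.coe_toReal h1 (ne_of_gt (lt_of_lt_of_le EReal.bot_lt_zero h2))).symm⟩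
  rw [hAJ, hA, EReal.coe_le_coe_iff] at hAJle
  have hmin2 := hmin (proj J w)
  have hprojw : s • (proj J w - wstar) = proj J u := by
    ext i
    have h1 := congrFun hJ i
    simp only [proj, hu, Pi.sub_apply, Pi.smul_apply, smul_eq_mul] at *
    split_ifs at *
    · rfl
    · rw [← h1]; simp
  rw [adaptiveObjective_eq hw0, hA, hloss, ← hu] at hmin1 hmin2
  rw [adaptiveObjective_eq (hzero (proj_proj J w)), weighted_proj, hAJ, hloss, hprojw] at hmin2
  norm_cast at hmin1 hmin2
  -- growth of the penalty off `J`
  have hgrow (i : Fin d) (hi : i ∉ J) : AJ + c * (ω / s) * |u i| ≤ A := by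
    have h1 := hΦ.growth i hi (weighted α w₀ w)
    rw [hA, hAJ] at h1
    norm_cast at h1
    have hwi : wstar i = 0 := by rw [← hJ]; exact proj_of_notMem hi wstar
    have h2 : ω / s * |u i| ≤ |weighted α w₀ w i| := by
      have h3 : |u i| = s * |w i| := by
        simp [hu, hwi, abs_mul, abs_of_pos hs]
      have h4 : ω / s * |u i| = ω * |w i| := by rw [h3]; field_simp
      rw [h4]
      rcases eq_or_ne (w i) 0 with h0 | h0
      · rw [h0, abs_zero, mul_zero]; positivity
      · rw [weighted, abs_mul, abs_abs]
        gcongr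
        exact (hω i hi fun h => h0 (hw0 i h)).trans (le_abs_self _)
    have := mul_le_mul_of_nonneg_left h2 hΦ.c_pos.le
    linarith
  -- the Lipschitz bound at the oracle point
  have hlip : B ≤ AJ + L * (Wmax / s) * ‖u - t‖ := by
    have h1 := hΦ.lipschitz (weighted α w₀ wt) (proj J (weighted α w₀ w))
      (by rw [← weighted_proj, hwtJ]) (proj_proj _ _) htr
    rw [hB, hAJ] at h1
    norm_cast at h1
    have h2 : ‖weighted α w₀ wt - proj J (weighted α w₀ w)‖ ≤ Wmax / s * ‖u - t‖ := by
      refine (pi_norm_le_iff_of_nonneg (by positivity)).2 fun i => ?_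
      rw [← weighted_proj, ← hwtJ]
      simp only [Pi.sub_apply, weighted]
      by_cases hi : i ∈ J
      · rw [proj_of_mem hi, proj_of_mem hi, ← mul_sub, norm_mul,
          Real.norm_of_nonneg (by positivity), div_mul_eq_mul_div, mul_div_assoc]
        refine mul_le_mul (hWmax i hi) ?_ (norm_nonneg _) hWmax0
        rw [le_div_iff₀ hs]
        have h3 : ‖|wt i| - |w i|‖ ≤ |wt i - w i| := abs_abs_sub_abs_le _ _
        have h4 : |wt i - w i| * s = |(u - t) i| := by
          have : wt i - w i = s⁻¹ * (t i - u i) := by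
            rw [hwt, hw]; simp; ring
          rw [this, abs_mul, abs_of_pos (inv_pos.2 hs), Pi.sub_apply u, abs_sub_comm]
          field_simp
        calc _ ≤ |wt i - w i| * s := by gcongr
          _ ≤ ‖u - t‖ := h4.trans_le (norm_le_pi_norm (u - t) i)
      · rw [proj_of_notMem hi, proj_of_notMem hi]; simp; positivity
    have := mul_le_mul_of_nonneg_left h2 hΦ.L_nonneg
    linarith
  have hsym : Cᵀ = C := by
    rw [hC, Matrix.transpose_smul, Matrix.transpose_mul, Matrix.transpose_transpose]
  have hL := hΦ.L_nonneg
  have hτ0 : 0 ≤ τ := by rw [hτ]; positivity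
  have hlast : 0 ≤ d * b * (2 * (d * ρ + τ) / μ) := by positivity
  -- comparison with the oracle point `t`
  have hclose : ‖u - t‖ ≤ 2 * (d * ρ + τ) / μ := by
    refine norm_sub_le_of_quad_add_le (Δ := lam * (A - B)) hsym hμ hpos ht hρ0 hτ0 hρ hR
      (m := m) ?_ ?_ ?_ ?_
    · refine le_trans ?_ hm.le
      gcongr; linarith
    · linarith
    · have := mul_le_mul_of_nonneg_left (hlip.trans (add_le_add_left hAJle _)) hlam.le
      rw [hτ]; linarith
    · intro i hi
      have h1 := mul_le_mul_of_nonneg_left (hgrow i hi) hlam.le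
      have h2 := mul_le_mul_of_nonneg_left hlip hlam.le
      rw [hτ, hmdef]; linarith
  refine ⟨hclose, fun i hi => ?_⟩
  -- comparison with the restriction of `u` to `J`
  have hui : u i = 0 := by
    refine eq_zero_of_quad_add_le (g := g) (Δ := lam * (A - AJ)) hsym
      (fun v => le_trans (by positivity) (hpos v))
      (R := R + d * b * (2 * (d * ρ + τ) / μ)) (by positivity) (fun i => ?_) hm ?_ ?_ ?_ hi
    · have h1 : C *ᵥ proj J u - g = (C *ᵥ t - g) + C *ᵥ (proj J u - t) := by
        rw [Matrix.mulVec_sub]; abel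
      rw [h1, Pi.add_apply]
      refine (abs_add_le _ _).trans (add_le_add (hR i) ?_)
      have h2 (j : Fin d) : |C i j * (proj J u - t) j| ≤ b * (2 * (d * ρ + τ) / μ) := by
        rw [abs_mul]
        refine mul_le_mul (hCb i j) ?_ (abs_nonneg _) hb
        refine le_trans ?_ ((norm_le_pi_norm (u - t) j).trans hclose)
        rw [← ht]
        simp only [Pi.sub_apply, proj]
        split_ifs <;> simp
      calc |(C *ᵥ (proj J u - t)) i| ≤ ∑ j, |C i j * (proj J u - t) j| := by
            simp only [Matrix.mulVec, dotProduct]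
            exact Finset.abs_sum_le_sum_abs _ _
        _ ≤ ∑ _j : Fin d, b * (2 * (d * ρ + τ) / μ) := Finset.sum_le_sum fun j _ => h2 j
        _ = d * b * (2 * (d * ρ + τ) / μ) := by simp; ring
    · linarith
    · exact mul_nonneg hlam.le (by linarith)
    · intro i hi
      have h1 := mul_le_mul_of_nonneg_left (hgrow i hi) hlam.le
      rw [hmdef]; linarith
  have hwi : wstar i = 0 := by rw [← hJ]; exact proj_of_notMem hi wstar
  rw [hw, Pi.add_apply, Pi.smul_apply, hui, hwi]; simp

/-! ### The deterministic limit argument -/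

lemma exists_pos_mul_norm_sq_le {d : ℕ} {Q : Matrix (Fin d) (Fin d) ℝ} (hQ : Q.PosDef) :
    ∃ μ : ℝ, 0 < μ ∧ ∀ v : Fin d → ℝ, μ * ‖v‖ ^ 2 ≤ v ⬝ᵥ Q *ᵥ v := by
  have hcont : Continuous fun v : Fin d → ℝ => v ⬝ᵥ Q *ᵥ v := by
    simp only [dotProduct, Matrix.mulVec]; fun_prop
  have hpos {v : Fin d → ℝ} (hv : v ≠ 0) : 0 < v ⬝ᵥ Q *ᵥ v := by
    simpa using hQ.dotProduct_mulVec_pos hv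
  obtain ⟨μ, hμ, h⟩ : ∃ μ : ℝ, 0 < μ ∧ ∀ v ∈ Metric.sphere (0 : Fin d → ℝ) 1,
      μ ≤ v ⬝ᵥ Q *ᵥ v := by
    rcases (Metric.sphere (0 : Fin d → ℝ) 1).eq_empty_or_nonempty with he | hne
    · exact ⟨1, one_pos, by simp [he]⟩
    · obtain ⟨x, hx, hmin⟩ := (isCompact_sphere (0 : Fin d → ℝ) 1).exists_isMinOn hne
        hcont.continuousOn
      exact ⟨_, hpos (ne_zero_of_mem_unit_sphere ⟨x, hx⟩), fun v hv => hmin hv⟩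
  refine ⟨μ, hμ, fun v => ?_⟩
  rcases eq_or_ne v 0 with rfl | hv
  · simp
  have hn : 0 < ‖v‖ := norm_pos_iff.2 hv
  have h1 := h (‖v‖⁻¹ • v) (by simp [norm_smul, hn.ne'])
  simp only [Matrix.mulVec_smul, dotProduct_smul, smul_dotProduct, smul_eq_mul] at h1
  calc μ * ‖v‖ ^ 2 ≤ ‖v‖⁻¹ * (‖v‖⁻¹ * (v ⬝ᵥ Q *ᵥ v)) * ‖v‖ ^ 2 := by gcongr
    _ = _ := by field_simp

lemma abs_mulVec_le {d : ℕ} {C : Matrix (Fin d) (Fin d) ℝ} {b : ℝ} (hb : 0 ≤ b)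
    (hC : ∀ i j, |C i j| ≤ b) (v : Fin d → ℝ) (i : Fin d) : |(C *ᵥ v) i| ≤ d * b * ‖v‖ := by
  simp only [Matrix.mulVec, dotProduct]
  calc |∑ j, C i j * v j| ≤ ∑ j, |C i j * v j| := Finset.abs_sum_le_sum_abs _ _
    _ ≤ ∑ _j : Fin d, b * ‖v‖ := Finset.sum_le_sum fun j _ => by
        rw [abs_mul]
        exact mul_le_mul (hC i j) (norm_le_pi_norm v j) (abs_nonneg _) hb
    _ = _ := by simp; ring

/-- The oracle least-squares direction: the vector supported on `J` whose restriction to `J` is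
`Q_JJ⁻¹ g_J`. -/
noncomputable def oracle {d : ℕ} (Q : Matrix (Fin d) (Fin d) ℝ) (J : Finset (Fin d))
    (g : Fin d → ℝ) : Fin d → ℝ :=
  fun i => if h : i ∈ J then
    ((Q.submatrix (fun i : J => (i : Fin d)) (fun i : J => (i : Fin d)))⁻¹ *ᵥ fun j : J => g j)
      ⟨i, h⟩ else 0

lemma proj_oracle {d : ℕ} (Q : Matrix (Fin d) (Fin d) ℝ) (J : Finset (Fin d)) (g : Fin d → ℝ) :
    proj J (oracle Q J g) = oracle Q J g := by
  ext i
  by_cases h : i ∈ J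
  · exact proj_of_mem h _
  · rw [proj_of_notMem h, oracle, dif_neg h]

lemma posDef_submatrix {d : ℕ} {Q : Matrix (Fin d) (Fin d) ℝ} (hQ : Q.PosDef)
    (J : Finset (Fin d)) :
    (Q.submatrix (fun i : J => (i : Fin d)) (fun i : J => (i : Fin d))).PosDef :=
  hQ.submatrix Subtype.val_injective

/-- The oracle direction solves the normal equations of the limit problem in the coordinates of
`J`. -/
lemma mulVec_oracle {d : ℕ} {Q : Matrix (Fin d) (Fin d) ℝ} (hQ : Q.PosDef) {J : Finset (Fin d)}
    (g : Fin d → ℝ) {j : Fin d} (hj : j ∈ J) : (Q *ᵥ oracle Q J g) j = g j := by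
  set QJ := Q.submatrix (fun i : J => (i : Fin d)) (fun i : J => (i : Fin d)) with hQJ
  have h1 : (QJ *ᵥ (QJ⁻¹ *ᵥ fun j : J => g j)) ⟨j, hj⟩ = g j := by
    rw [Matrix.mulVec_mulVec, Matrix.mul_nonsing_inv _
      ((Matrix.isUnit_iff_isUnit_det _).1 (posDef_submatrix hQ J).isUnit), Matrix.one_mulVec]
  rw [← h1]
  simp only [Matrix.mulVec, dotProduct]
  rw [← Finset.sum_subset (Finset.subset_univ J), ← Finset.sum_coe_sort J]
  · refine Finset.sum_congr rfl fun k _ => ?_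
    simp only [oracle, dif_pos k.2]
    rfl
  · intro k _ hk
    simp [oracle, hk]

lemma exists_norm_oracle_le {d : ℕ} (Q : Matrix (Fin d) (Fin d) ℝ) (J : Finset (Fin d)) :
    ∃ b : ℝ, 0 ≤ b ∧ ∀ g, ‖oracle Q J g‖ ≤ b * ‖g‖ := by
  set B := (Q.submatrix (fun i : J => (i : Fin d)) (fun i : J => (i : Fin d)))⁻¹ with hB
  refine ⟨∑ i, ∑ j, |B i j|,
    Finset.sum_nonneg fun _ _ => Finset.sum_nonneg fun _ _ => abs_nonneg _, fun g => ?_⟩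
  refine (pi_norm_le_iff_of_nonneg (by positivity)).2 fun i => ?_
  by_cases h : i ∈ J
  · rw [oracle, dif_pos h]
    simp only [Matrix.mulVec, dotProduct]
    calc ‖∑ j : J, B ⟨i, h⟩ j * g j‖ ≤ ∑ j : J, |B ⟨i, h⟩ j| * ‖g‖ := by
          refine (norm_sum_le _ _).trans (Finset.sum_le_sum fun j _ => ?_)
          rw [norm_mul, Real.norm_eq_abs]
          gcongr
          exact norm_le_pi_norm g j
      _ = (∑ j : J, |B ⟨i, h⟩ j|) * ‖g‖ := (Finset.sum_mul _ _ _).symm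
      _ ≤ _ := by
          refine mul_le_mul_of_nonneg_right ?_ (norm_nonneg g)
          exact Finset.single_le_sum (f := fun i => ∑ j, |B i j|)
            (fun _ _ => Finset.sum_nonneg fun _ _ => abs_nonneg _) (Finset.mem_univ (⟨i, h⟩ : J))
  · rw [oracle, dif_neg h, norm_zero]; positivity

lemma proj_supp {d : ℕ} (w : Fin d → ℝ) : proj (supp w) w = w := by
  ext i
  by_cases h : i ∈ supp w
  · exact proj_of_mem h w
  · rw [proj_of_notMem h]
    rw [mem_supp, not_not] at h
    exact h.symm

/-- Near a nonzero coordinate the weights are bounded and the weighted coordinate is continuous. -/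
lemma exists_weight_control {α r a : ℝ} (hr : 0 < r) (ha : a ≠ 0) :
    ∃ δ > 0, ∀ x y : ℝ, |x - a| < δ → |y - a| < δ →
      x ≠ 0 ∧ |x| ^ (α - 1) ≤ |a| ^ (α - 1) + 1 ∧
        abs (|x| ^ (α - 1) * |y| - |a| ^ (α - 1) * |a|) ≤ r := by
  have h1 : ContinuousAt (fun z : ℝ × ℝ => |z.1| ^ (α - 1)) (a, a) :=
    ContinuousAt.rpow_const (by fun_prop) (.inl (abs_ne_zero.2 ha))
  have h2 : ContinuousAt (fun z : ℝ × ℝ => |z.1| ^ (α - 1) * |z.2|) (a, a) :=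
    h1.mul (by fun_prop)
  have h3 : ∀ᶠ z : ℝ × ℝ in 𝓝 (a, a), z.1 ≠ 0 ∧ |z.1| ^ (α - 1) ≤ |a| ^ (α - 1) + 1 ∧
      abs (|z.1| ^ (α - 1) * |z.2| - |a| ^ (α - 1) * |a|) ≤ r := by
    refine ((continuousAt_fst (p := (a, a))).eventually_ne ha).and ?_
    refine (h1.eventually_le_const (lt_add_one _)).and ?_
    filter_upwards [Metric.tendsto_nhds.1 h2 r hr] with z hz
    exact hz.le
  obtain ⟨δ, hδ, h⟩ := Metric.eventually_nhds_iff.1 h3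
  exact ⟨δ, hδ, fun x y hx hy => h (y := (x, y)) (by
    rw [Prod.dist_eq]; exact max_lt hx hy)⟩

/-- Off `J` the initial estimator is at most `K / √n`, so that the weights are at least
`(K / √n)^{α-1}`; this is their size in the local parameter. -/
lemma weight_rate {K α : ℝ} (hK : 0 < K) {n : ℕ} (hn : 0 < n) :
    (K / √(n : ℝ)) ^ (α - 1) / √(n : ℝ) = K ^ (α - 1) / (n : ℝ) ^ (α / 2) := by
  have hn' : (0 : ℝ) < n := by exact_mod_cast hn
  have hs : 0 < √(n : ℝ) := by positivity
  have h1 : (n : ℝ) ^ (α / 2) = √(n : ℝ) ^ (α - 1) * √(n : ℝ) := by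
    rw [← Real.rpow_add_one hs.ne', sub_add_cancel, Real.sqrt_eq_rpow, ← Real.rpow_mul hn'.le]
    congr 1; ring
  rw [Real.div_rpow hK.le hs.le, h1, div_div]

/-- On the event where the noise term and the error of the initial estimator are bounded by `K`,
the adaptive estimator is, uniformly for large `n`, close to its oracle approximation and to the
true parameter, and it has the right support. -/
theorem eventually_estimator_bound {d : ℕ} {Φ : (Fin d → ℝ) → EReal} {wstar : Fin d → ℝ}
    {α c r L : ℝ} (hα1 : α < 1)
    (hΦ : IsStablePenaltyAt Φ (supp wstar) (weighted α wstar wstar) c r L)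
    {X : ∀ n : ℕ, Matrix (Fin n) (Fin d) ℝ} {Q : Matrix (Fin d) (Fin d) ℝ} (hQ : Q.PosDef)
    (hX : Tendsto (fun n : ℕ => (n : ℝ)⁻¹ • ((X n)ᵀ * X n)) atTop (𝓝 Q))
    {lam : ℕ → ℝ} (hlam_pos : ∀ n, 0 < lam n)
    (hlam_zero : Tendsto (fun n : ℕ => lam n / √(n : ℝ)) atTop (𝓝 0))
    (hlam_top : Tendsto (fun n : ℕ => lam n / (n : ℝ) ^ (α / 2)) atTop atTop)
    {K η : ℝ} (hK : 0 < K) (hη : 0 < η) :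
    ∀ᶠ n : ℕ in atTop, ∀ (e : Fin n → ℝ) (w₀ w : Fin d → ℝ),
      ‖(√(n : ℝ))⁻¹ • ((X n)ᵀ *ᵥ e)‖ ≤ K → √(n : ℝ) * ‖w₀ - wstar‖ ≤ K →
      (∀ w', adaptiveObjective Φ α (lam n) (X n) (fun i => (X n *ᵥ wstar) i + e i) w₀ w ≤
        adaptiveObjective Φ α (lam n) (X n) (fun i => (X n *ᵥ wstar) i + e i) w₀ w') →
      ‖√(n : ℝ) • (w - wstar) - oracle Q (supp wstar) ((√(n : ℝ))⁻¹ • ((X n)ᵀ *ᵥ e))‖ ≤ η ∧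
        supp w = supp wstar ∧ ‖w - wstar‖ ≤ η := by
  set J := supp wstar with hJ
  obtain ⟨μ, hμ, hQμ⟩ := exists_pos_mul_norm_sq_le hQ
  obtain ⟨β, hβ, hor⟩ := exists_norm_oracle_le Q J
  -- the accuracy `δ` needed for the Gram matrices
  obtain ⟨δ₁, hδ₁, hδ₁'⟩ := exists_pos_mul_lt (half_pos hμ) ((d : ℝ) ^ 2)
  obtain ⟨δ₂, hδ₂, hδ₂'⟩ := exists_pos_mul_lt (show 0 < η * μ / 8 by positivity)
    ((d : ℝ) * (d * (β * K)))
  set δ := min (min δ₁ δ₂) 1 with hδdef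
  have hδ : 0 < δ := lt_min (lt_min hδ₁ hδ₂) one_pos
  have hδ1 : (d : ℝ) ^ 2 * δ ≤ μ / 2 := by
    refine le_trans ?_ hδ₁'.le
    gcongr; exact (min_le_left _ _).trans (min_le_left _ _)
  set ρ := d * δ * (β * K) with hρdef
  have hδ2 : d * ρ ≤ η * μ / 8 := by
    calc d * ρ = d * (d * (β * K)) * δ := by rw [hρdef]; ring
      _ ≤ d * (d * (β * K)) * δ₂ := by
        gcongr; exact (min_le_left _ _).trans (min_le_right _ _)
      _ ≤ _ := hδ₂'.le
  set b := ∑ i, ∑ j, |Q i j| + 1 with hbdef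
  have hb : 0 ≤ b := by positivity
  set R := d * b * (β * K) + K with hRdef
  set Wmax := ∑ j, (|wstar j| ^ (α - 1) + 1) with hWdef
  have hWmax0 : 0 ≤ Wmax := by positivity
  have hsqrt : Tendsto (fun n : ℕ => √(n : ℝ)) atTop atTop :=
    Real.tendsto_sqrt_atTop.comp tendsto_natCast_atTop_atTop
  have hsmall (A : ℝ) {x : ℝ} (hx : 0 < x) : ∀ᶠ n : ℕ in atTop, A / √(n : ℝ) < x :=
    (hsqrt.const_div_atTop A).eventually_lt_const hx
  have hgram : ∀ᶠ n : ℕ in atTop, ∀ i j, |((n : ℝ)⁻¹ • ((X n)ᵀ * X n)) i j - Q i j| ≤ δ := by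
    refine eventually_all.2 fun i => eventually_all.2 fun j => ?_
    have h1 := tendsto_pi_nhds.1 (tendsto_pi_nhds.1 hX i) j
    filter_upwards [Metric.tendsto_nhds.1 h1 δ hδ] with n hn
    exact hn.le
  -- the penalty becomes flat on `ℝ^J`, at rate `λ_n / √n`
  have hτ : ∀ᶠ n : ℕ in atTop, lam n * (L * (Wmax / √(n : ℝ))) ≤ η * μ / 8 := by
    have h1 := hlam_zero.const_mul (L * Wmax)
    rw [mul_zero] at h1
    filter_upwards [h1.eventually_lt_const (show 0 < η * μ / 8 by positivity)] with n hn
    exact le_of_eq_of_le (by ring) hn.le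
  -- and steep off `J`, at rate `λ_n / n^{α/2}`
  have hm : ∀ᶠ n : ℕ in atTop,
      d * (R + d * b * η) < lam n * (c * ((K / √(n : ℝ)) ^ (α - 1) / √(n : ℝ))) := by
    have h1 := hlam_top.const_mul_atTop (mul_pos hΦ.c_pos (Real.rpow_pos_of_pos hK (α - 1)))
    filter_upwards [h1.eventually_gt_atTop (d * (R + d * b * η)), eventually_gt_atTop 0]
      with n hn hn0
    rw [weight_rate hK hn0]
    exact lt_of_lt_of_eq hn (by ring)
  have hweights : ∀ᶠ n : ℕ in atTop, ∀ j ∈ J, ∀ x y : ℝ, |x - wstar j| ≤ K / √(n : ℝ) →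
      |y - wstar j| ≤ β * K / √(n : ℝ) → x ≠ 0 ∧ |x| ^ (α - 1) ≤ |wstar j| ^ (α - 1) + 1 ∧
        abs (|x| ^ (α - 1) * |y| - |wstar j| ^ (α - 1) * |wstar j|) ≤ r := by
    refine eventually_all.2 fun j => ?_
    by_cases hj : j ∈ J
    swap; · exact Eventually.of_forall fun _ h => absurd h hj
    obtain ⟨κ, hκ, h⟩ := exists_weight_control (α := α) hΦ.r_pos (mem_supp.1 hj)
    filter_upwards [hsmall K hκ, hsmall (β * K) hκ] with n h1 h2 _ x y hx hy
    exact h x y (hx.trans_lt h1) (hy.trans_lt h2)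
  have hsupp : ∀ᶠ n : ℕ in atTop, ∀ j ∈ J, (η + β * K) / √(n : ℝ) < |wstar j| := by
    refine eventually_all.2 fun j => ?_
    by_cases hj : j ∈ J
    swap; · exact Eventually.of_forall fun _ h => absurd h hj
    filter_upwards [hsmall (η + β * K) (abs_pos.2 (mem_supp.1 hj))] with n hn _ using hn
  filter_upwards [hgram, hτ, hm, hweights, hsupp, hsmall (η + β * K) hη, eventually_gt_atTop 0]
    with n hgram hτ hm hweights hsupp hcons hn e w₀ w hgK hw₀K hmin
  have hs : 0 < √(n : ℝ) := by positivity
  have hL := hΦ.L_nonneg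
  have hlam := hlam_pos n
  set C := (n : ℝ)⁻¹ • ((X n)ᵀ * X n) with hC
  set g := (√(n : ℝ))⁻¹ • ((X n)ᵀ *ᵥ e) with hg
  set t := oracle Q J g with ht
  have htK : ‖t‖ ≤ β * K := (hor g).trans (by gcongr)
  have hCb (i j : Fin d) : |C i j| ≤ b := by
    have h1 : |Q i j| ≤ ∑ i, ∑ j, |Q i j| :=
      (Finset.single_le_sum (f := fun j => |Q i j|) (fun _ _ => abs_nonneg _)
        (Finset.mem_univ j)).trans
      (Finset.single_le_sum (f := fun i => ∑ j, |Q i j|)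
        (fun _ _ => Finset.sum_nonneg fun _ _ => abs_nonneg _) (Finset.mem_univ i))
    have h2 := hgram i j
    have h3 : δ ≤ 1 := min_le_right _ _
    have h4 : |C i j| ≤ |C i j - Q i j| + |Q i j| := by
      simpa using abs_add_le (C i j - Q i j) (Q i j)
    linarith
  have hCQ (v : Fin d → ℝ) (i : Fin d) : |((C - Q) *ᵥ v) i| ≤ d * δ * ‖v‖ :=
    abs_mulVec_le hδ.le (fun i j => hgram i j) v i
  -- half of the coercivity of `Q` survives in `C`
  have hpos (v : Fin d → ℝ) : μ / 2 * ‖v‖ ^ 2 ≤ v ⬝ᵥ C *ᵥ v := by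
    have h1 : |v ⬝ᵥ (C - Q) *ᵥ v| ≤ d ^ 2 * δ * ‖v‖ ^ 2 := by
      refine abs_dotProduct_le (fun i => ?_) (by positivity)
      rw [abs_mul]
      calc d * (|v i| * |((C - Q) *ᵥ v) i|) ≤ d * (‖v‖ * (d * δ * ‖v‖)) := by
            gcongr
            · exact norm_le_pi_norm v i
            · exact hCQ v i
        _ = _ := by ring
    have h2 : v ⬝ᵥ C *ᵥ v = v ⬝ᵥ Q *ᵥ v + v ⬝ᵥ (C - Q) *ᵥ v := by
      rw [Matrix.sub_mulVec, dotProduct_sub]; ring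
    have h3 := (abs_le.1 h1).1
    have h4 := hQμ v
    have h5 : (d : ℝ) ^ 2 * δ * ‖v‖ ^ 2 ≤ μ / 2 * ‖v‖ ^ 2 := by gcongr
    linarith
  have hw₀ (i : Fin d) : |w₀ i - wstar i| ≤ K / √(n : ℝ) := by
    rw [le_div_iff₀' hs]
    refine le_trans ?_ hw₀K
    gcongr
    exact norm_le_pi_norm (w₀ - wstar) i
  have htn (i : Fin d) : |(wstar + (√(n : ℝ))⁻¹ • t) i - wstar i| ≤ β * K / √(n : ℝ) := by
    rw [Pi.add_apply, add_sub_cancel_left, Pi.smul_apply, smul_eq_mul, abs_mul,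
      abs_of_pos (inv_pos.2 hs), inv_mul_eq_div]
    gcongr
    exact (norm_le_pi_norm t i).trans htK
  have hacc : 2 * (d * ρ + lam n * (L * (Wmax / √(n : ℝ)))) / (μ / 2) ≤ η := by
    rw [div_le_iff₀ (by positivity)]; linarith
  have hm' : d * (R + d * b * (2 * (d * ρ + lam n * (L * (Wmax / √(n : ℝ)))) / (μ / 2))) <
      lam n * (c * ((K / √(n : ℝ)) ^ (α - 1) / √(n : ℝ))) := lt_of_le_of_lt (by gcongr) hm
  obtain ⟨hclose, hoff⟩ := estimator_bound hn hΦ (proj_supp wstar) hlam hmin (Wmax := Wmax)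
    (ω := (K / √(n : ℝ)) ^ (α - 1)) (t := t) (C := C) (g := g) (μ := μ / 2) (ρ := ρ) (R := R)
    (b := b)
    (fun j hj => (hweights j hj _ _ (hw₀ j) (htn j)).1)
    (fun j hj => (hweights j hj _ _ (hw₀ j) (htn j)).2.1.trans
      (Finset.single_le_sum (f := fun j => |wstar j| ^ (α - 1) + 1)
        (fun _ _ => by positivity) (Finset.mem_univ j)))
    hWmax0
    (fun i hi h0 => by
      have h1 : wstar i = 0 := by_contra fun h => hi (mem_supp.2 h)
      have h2 := hw₀ i
      rw [h1, sub_zero] at h2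
      exact Real.rpow_le_rpow_of_nonpos (abs_pos.2 h0) h2 (by linarith))
    (proj_oracle Q J g)
    (by
      refine (pi_norm_le_iff_of_nonneg hΦ.r_pos.le).2 fun i => ?_
      by_cases hi : i ∈ J
      · exact (hweights i hi _ _ (hw₀ i) (htn i)).2.2
      · have h1 : wstar i = 0 := by_contra fun h => hi (mem_supp.2 h)
        have h2 : t i = 0 := by rw [ht, ← proj_oracle]; exact proj_of_notMem hi _
        simp [weighted, h1, h2, hΦ.r_pos.le])
    hC hg (by positivity) hpos hCb hb (by positivity)
    (fun j hj => by
      have h1 : (C *ᵥ t - g) j = ((C - Q) *ᵥ t) j := by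
        rw [Matrix.sub_mulVec, Pi.sub_apply, Pi.sub_apply, mulVec_oracle hQ g hj]
      rw [h1]
      exact (hCQ t j).trans (mul_le_mul_of_nonneg_left htK (by positivity)))
    (by positivity)
    (fun i => by
      rw [Pi.sub_apply]
      refine (abs_sub _ _).trans (add_le_add ((abs_mulVec_le hb hCb t i).trans ?_) ?_)
      · gcongr
      · exact (norm_le_pi_norm g i).trans hgK)
    rfl rfl hm'
  have hclose' := hclose.trans hacc
  have hdist : ‖w - wstar‖ ≤ (η + β * K) / √(n : ℝ) := by
    rw [le_div_iff₀' hs]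
    calc √(n : ℝ) * ‖w - wstar‖ = ‖√(n : ℝ) • (w - wstar)‖ := by
          rw [norm_smul, Real.norm_of_nonneg hs.le]
      _ = ‖(√(n : ℝ) • (w - wstar) - t) + t‖ := by rw [sub_add_cancel]
      _ ≤ _ := (norm_add_le _ _).trans (add_le_add hclose' htK)
  refine ⟨hclose', ?_, hdist.trans hcons.le⟩
  ext i
  by_cases hi : i ∈ J
  · refine iff_of_true (mem_supp.2 fun h0 => ?_) hi
    have h1 := (norm_le_pi_norm (w - wstar) i).trans_lt (hdist.trans_lt (hsupp i hi))
    rw [Pi.sub_apply, h0, zero_sub, norm_neg, Real.norm_eq_abs] at h1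
    exact lt_irrefl _ h1
  · exact iff_of_false (fun h => mem_supp.1 h (hoff i hi)) hi

/-! ### A central limit theorem for weighted sums -/

lemma norm_prod_sub_prod_le {ι : Type*} (s : Finset ι) {a b : ι → ℂ} (ha : ∀ i ∈ s, ‖a i‖ ≤ 1)
    (hb : ∀ i ∈ s, ‖b i‖ ≤ 1) : ‖∏ i ∈ s, a i - ∏ i ∈ s, b i‖ ≤ ∑ i ∈ s, ‖a i - b i‖ := by
  classical
  induction s using Finset.induction with
  | empty => simp
  | insert j s hj ih =>
    rw [Finset.prod_insert hj, Finset.prod_insert hj, Finset.sum_insert hj]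
    have h1 : ‖∏ i ∈ s, a i‖ ≤ 1 := by
      rw [norm_prod]
      exact Finset.prod_le_one (fun _ _ => norm_nonneg _)
        fun i hi => ha i (Finset.mem_insert_of_mem hi)
    have h2 := ih (fun i hi => ha i (Finset.mem_insert_of_mem hi))
      (fun i hi => hb i (Finset.mem_insert_of_mem hi))
    calc ‖a j * ∏ i ∈ s, a i - b j * ∏ i ∈ s, b i‖
        = ‖(a j - b j) * ∏ i ∈ s, a i + b j * (∏ i ∈ s, a i - ∏ i ∈ s, b i)‖ := by ring_nf
      _ ≤ ‖a j - b j‖ * ‖∏ i ∈ s, a i‖ + ‖b j‖ * ‖∏ i ∈ s, a i - ∏ i ∈ s, b i‖ := by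
          rw [← norm_mul, ← norm_mul]; exact norm_add_le _ _
      _ ≤ ‖a j - b j‖ * 1 + 1 * ∑ i ∈ s, ‖a i - b i‖ := by
          gcongr
          exact hb j (Finset.mem_insert_self j s)
      _ = _ := by ring

/-- A centered square-integrable variable and the centered Gaussian of the same variance have
characteristic functions that agree to second order at `0`. -/
lemma charFun_sub_exp_isLittleO {S : Type*} [MeasurableSpace S] {P : Measure S}
    [IsProbabilityMeasure P] {Y : S → ℝ} (hY : MemLp Y 2 P) (h0 : ∫ s, Y s ∂P = 0) :
    (fun t : ℝ => charFun (P.map Y) t - Complex.exp (-(variance Y P * t ^ 2 / 2))) =o[𝓝 0]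
      fun t => t ^ 2 := by
  have hm : AEMeasurable Y P := hY.aestronglyMeasurable.aemeasurable
  have hprob : IsProbabilityMeasure (P.map Y) := Measure.isProbabilityMeasure_map hm
  have hmem : MemLp id 2 (P.map Y) := (memLp_map_measure_iff (by fun_prop) hm).2 hY
  have hv : variance Y P = P[Y ^ 2] := by
    rw [variance_of_integral_eq_zero hm h0]; rfl
  have h1 : (fun t : ℝ => charFun (P.map Y) t - (1 - (variance Y P : ℂ) * t ^ 2 / 2)) =o[𝓝 0]
      fun t => t ^ 2 := by
    have h2 (t : ℝ) : (1 - (variance Y P : ℂ) * t ^ 2 / 2) =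
        taylorWithinEval (charFun (P.map Y)) 2 Set.univ 0 t := by
      rw [taylorWithinEval_charFun_two_zero hm hmem, h0, hv]; simp
    simp_rw [h2]
    have h3 := taylor_isLittleO_univ (x₀ := (0 : ℝ)) (contDiff_charFun (n := 2) hmem)
    simpa using h3
  have h2 : (fun t : ℝ => Complex.exp (-(variance Y P * t ^ 2 / 2))
      - (1 - (variance Y P : ℂ) * t ^ 2 / 2)) =o[𝓝 0] fun t => t ^ 2 := by
    have h3 : (fun z : ℂ => Complex.exp z - 1 - z) =o[𝓝 0] fun z => z := by
      have := (hasDerivAt_iff_isLittleO.1 (Complex.hasDerivAt_exp 0))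
      simpa using this
    have h4 : Tendsto (fun t : ℝ => -((variance Y P : ℂ) * t ^ 2 / 2)) (𝓝 0) (𝓝 0) := by
      have : Continuous fun t : ℝ => -((variance Y P : ℂ) * t ^ 2 / 2) := by fun_prop
      simpa using this.tendsto 0
    have h5 := h3.comp_tendsto h4
    refine (h5.congr_left fun t => ?_).trans_isBigO ?_
    · simp only [Function.comp]; ring
    · refine Asymptotics.IsBigO.of_bound (|variance Y P| / 2) (Eventually.of_forall fun t => ?_)
      simp
      exact le_of_eq (by ring)
  simpa using h1.sub h2

/-- Products of functions with a second-order Gaussian expansion at `0`, along an asymptotically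
negligible array, have a Gaussian limit. -/
lemma tendsto_prod_of_isLittleO {φ : ℝ → ℂ} (hφ : ∀ t, ‖φ t‖ ≤ 1) {V : ℝ} (hV : 0 ≤ V)
    (hφV : (fun t : ℝ => φ t - Complex.exp (-(V * t ^ 2 / 2))) =o[𝓝 0] fun t => t ^ 2)
    {a : ∀ n : ℕ, Fin n → ℝ} (ha : ∀ δ : ℝ, 0 < δ → ∀ᶠ n in atTop, ∀ i, |a n i| ≤ δ)
    {v : ℝ} (hv : Tendsto (fun n => ∑ i, a n i ^ 2) atTop (𝓝 v)) :
    Tendsto (fun n => ∏ i, φ (a n i)) atTop (𝓝 (Complex.exp (-(V * v / 2)))) := by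
  have h1 : Tendsto (fun n => ∏ i, Complex.exp (-((V : ℂ) * (a n i : ℂ) ^ 2 / 2))) atTop
      (𝓝 (Complex.exp (-(V * v / 2)))) := by
    have h2 : ∀ n, ∏ i, Complex.exp (-((V : ℂ) * (a n i : ℂ) ^ 2 / 2)) =
        Complex.exp (-((V : ℂ) * ((∑ i, a n i ^ 2 : ℝ) : ℂ) / 2)) := by
      intro n
      rw [← Complex.exp_sum]
      congr 1
      push_cast
      rw [Finset.sum_neg_distrib, Finset.mul_sum, Finset.sum_div]
    simp_rw [h2]
    have hc : Continuous fun x : ℝ => Complex.exp (-((V : ℂ) * (x : ℂ) / 2)) := by fun_prop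
    exact (hc.tendsto v).comp hv
  -- replacing each factor by a Gaussian one costs `o(1)` times the sum of squares
  have h3 : Tendsto (fun n => ∏ i, φ (a n i) -
      ∏ i, Complex.exp (-((V : ℂ) * (a n i : ℂ) ^ 2 / 2))) atTop (𝓝 0) := by
    rw [Metric.tendsto_nhds]
    intro η hη
    have hv0 : 0 ≤ v := ge_of_tendsto' hv fun n => Finset.sum_nonneg fun _ _ => sq_nonneg _
    have hc : 0 < η / (2 * (v + 1)) := by positivity
    obtain ⟨δ, hδ, h⟩ := Metric.eventually_nhds_iff.1 (hφV.bound hc)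
    filter_upwards [ha (δ / 2) (half_pos hδ), hv.eventually_lt_const (lt_add_one v)] with n hn hvn
    rw [dist_zero_right]
    calc _ ≤ ∑ i, ‖φ (a n i) - Complex.exp (-((V : ℂ) * (a n i : ℂ) ^ 2 / 2))‖ := by
          refine norm_prod_sub_prod_le _ (fun i _ => hφ _) fun i _ => ?_
          rw [Complex.norm_exp, Real.exp_le_one_iff]
          have : (-((V : ℂ) * (a n i : ℂ) ^ 2 / 2)).re = -(V * a n i ^ 2 / 2) := by
            norm_cast
          rw [this, neg_nonpos]
          positivity
      _ ≤ ∑ i, η / (2 * (v + 1)) * a n i ^ 2 := by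
          refine Finset.sum_le_sum fun i _ => ?_
          have h5 := h (y := a n i) (by
            rw [dist_zero_right, Real.norm_eq_abs]; exact (hn i).trans_lt (half_lt_self hδ))
          simpa using h5
      _ = η / (2 * (v + 1)) * ∑ i, a n i ^ 2 := (Finset.mul_sum _ _ _).symm
      _ ≤ η / (2 * (v + 1)) * (v + 1) := by gcongr
      _ = η / 2 := by field_simp
      _ < η := half_lt_self hη
  simpa using h3.add h1

/-- The characteristic function of a weighted sum, evaluated at `1` because the frequency is part of
the weights. -/
lemma charFun_map_sum_mul {S : Type*} [MeasurableSpace S] {P : Measure S}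
    {ε : ℕ → S → ℝ} (hindep : iIndepFun ε P)
    (hident : ∀ i, IdentDistrib (ε i) (ε 0) P P) {n : ℕ} (a : Fin n → ℝ) :
    charFun (P.map fun s => ∑ i : Fin n, a i * ε i s) 1 = ∏ i, charFun (P.map (ε 0)) (a i) := by
  have hm (i : ℕ) : AEMeasurable (ε i) P := (hident i).aemeasurable_fst
  have h1 : iIndepFun (fun (i : Fin n) s => a i * ε i s) P :=
    (hindep.precomp Fin.val_injective).comp (fun i x => a i * x) fun i => by fun_prop
  rw [iIndepFun.charFun_map_fun_sum_eq_prod (fun i : Fin n => (hm i).const_mul (a i)) h1,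
    Finset.prod_apply]
  refine Finset.prod_congr rfl fun i _ => ?_
  rw [charFun_map_mul_comp (hm i), mul_one, (hident i).map_eq]

lemma aemeasurable_of_inner {S : Type*} [MeasurableSpace S] {P : Measure S}
    {ι : Type*} [Fintype ι] {Z : S → EuclideanSpace ℝ ι}
    (h : ∀ t, AEMeasurable (fun s => inner ℝ (Z s) t) P) : AEMeasurable Z P := by
  classical
  have h1 : Z = fun s => WithLp.toLp 2 fun k => inner ℝ (Z s) (EuclideanSpace.single k 1) := by
    ext s k
    simp [EuclideanSpace.inner_single_right]
  rw [h1]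
  exact (WithLp.measurable_toLp 2 (ι → ℝ)).comp_aemeasurable (aemeasurable_pi_lambda _ fun k => h _)

/-- **Central limit theorem for weighted sums** of i.i.d. variables: random vectors whose linear
functionals are sums of the noise against asymptotically negligible weights, of convergent square
sums, are asymptotically normal. -/
theorem tendstoInDistribution_of_weighted_sums {S : Type*} [MeasurableSpace S] {P : Measure S}
    [IsProbabilityMeasure P] {ι : Type*} [Fintype ι] [DecidableEq ι]
    {ε : ℕ → S → ℝ} (hindep : iIndepFun ε P) (hident : ∀ i, IdentDistrib (ε i) (ε 0) P P)
    (hmem : MemLp (ε 0) 2 P) (hmean : ∫ s, ε 0 s ∂P = 0)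
    {Z : ℕ → S → EuclideanSpace ℝ ι} {a : EuclideanSpace ℝ ι → ∀ n : ℕ, Fin n → ℝ}
    (hZ : ∀ n t s, inner ℝ (Z n s) t = ∑ i : Fin n, a t n i * ε i s)
    (ha : ∀ t, ∀ δ : ℝ, 0 < δ → ∀ᶠ n in atTop, ∀ i, |a t n i| ≤ δ)
    {Γ : Matrix ι ι ℝ} (hΓ : Γ.PosSemidef)
    (hlim : ∀ t : EuclideanSpace ℝ ι,
      Tendsto (fun n => ∑ i, a t n i ^ 2) atTop (𝓝 (t.ofLp ⬝ᵥ Γ *ᵥ t.ofLp))) :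
    TendstoInDistribution Z atTop (id : EuclideanSpace ℝ ι → EuclideanSpace ℝ ι) (fun _ => P)
      (multivariateGaussian 0 (variance (ε 0) P • Γ)) where
  forall_aemeasurable n := aemeasurable_of_inner fun t => by
    simp_rw [hZ]
    exact Finset.aemeasurable_fun_sum _ fun i _ => ((hident i).aemeasurable_fst).const_mul _
  tendsto := by
    refine ProbabilityMeasure.tendsto_iff_tendsto_charFun.2 fun t => ?_
    have hV := variance_nonneg (ε 0) P
    simp only [ProbabilityMeasure.coe_mk, Measure.map_id]
    have hsum (n : ℕ) : AEMeasurable (fun s => ∑ i : Fin n, a t n i * ε i s) P :=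
      Finset.aemeasurable_fun_sum _ fun i _ => ((hident i).aemeasurable_fst).const_mul _
    have hZm (n : ℕ) : AEMeasurable (Z n) P := aemeasurable_of_inner fun t => by
      simp_rw [hZ]
      exact Finset.aemeasurable_fun_sum _ fun i _ => ((hident i).aemeasurable_fst).const_mul _
    rw [charFun_multivariateGaussian (hΓ.smul hV)]
    have h1 (n : ℕ) : charFun (P.map (Z n)) t = ∏ i, charFun (P.map (ε 0)) (a t n i) := by
      rw [← charFun_map_sum_mul hindep hident, charFun_apply, charFun_apply,
        integral_map (hZm n) (by fun_prop), integral_map (hsum n) (by fun_prop)]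
      simp [hZ]
    simp_rw [h1]
    have : IsProbabilityMeasure (P.map (ε 0)) :=
      Measure.isProbabilityMeasure_map (hident 0).aemeasurable_fst
    convert tendsto_prod_of_isLittleO (fun t => norm_charFun_le_one t) hV
      (charFun_sub_exp_isLittleO hmem hmean) (ha t) (hlim t) using 3
    simp [Matrix.smul_mulVec, dotProduct_smul]

/-- **Chebyshev's inequality** for weighted sums of i.i.d. centered variables. -/
lemma measure_weighted_sum_le {S : Type*} [MeasurableSpace S] {P : Measure S}
    [IsProbabilityMeasure P] {ε : ℕ → S → ℝ} (hindep : iIndepFun ε P)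
    (hident : ∀ i, IdentDistrib (ε i) (ε 0) P P) (hmem : MemLp (ε 0) 2 P)
    (hmean : ∫ s, ε 0 s ∂P = 0) {n : ℕ} (a : Fin n → ℝ) {K : ℝ} (hK : 0 < K) :
    P {s | K ≤ |∑ i : Fin n, a i * ε i s|} ≤
      ENNReal.ofReal ((∑ i, a i ^ 2) * variance (ε 0) P / K ^ 2) := by
  have hmem' (i : ℕ) : MemLp (ε i) 2 P := (hident i).memLp_iff.2 hmem
  have hma (i : Fin n) : MemLp (fun s => a i * ε i s) 2 P := (hmem' i).const_mul _
  have hsum : MemLp (fun s => ∑ i : Fin n, a i * ε i s) 2 P :=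
    memLp_finsetSum _ fun i _ => hma i
  have h0 : ∫ s, ∑ i : Fin n, a i * ε i s ∂P = 0 := by
    rw [integral_finsetSum _ fun i _ => (hma i).integrable (by norm_num)]
    refine Finset.sum_eq_zero fun i _ => ?_
    rw [integral_const_mul, (hident i).integral_eq, hmean, mul_zero]
  have hvar : variance (fun s => ∑ i : Fin n, a i * ε i s) P =
      (∑ i, a i ^ 2) * variance (ε 0) P := by
    have h1 : iIndepFun (fun (i : Fin n) s => a i * ε i s) P :=
      (hindep.precomp Fin.val_injective).comp (fun i x => a i * x) fun i => by fun_prop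
    have h2 := IndepFun.variance_sum (s := Finset.univ) (fun i _ => hma i)
      (fun i _ j _ hij => h1.indepFun hij)
    rw [Finset.sum_mul]
    convert h2 using 2
    · ext s; simp
    · rw [variance_const_mul, ← (hident _).variance_eq]
  have h3 := meas_ge_le_variance_div_sq hsum hK
  rw [h0, hvar] at h3
  simpa using h3

/-! ### The noise term of an asymptotic design -/

/-- If the averages of a sequence of real numbers converge, the `n`-th term is `o(n)`. -/
lemma tendsto_div_succ_of_tendsto_average {x : ℕ → ℝ} {q : ℝ}
    (h : Tendsto (fun n : ℕ => (n : ℝ)⁻¹ * ∑ i ∈ Finset.range n, x i) atTop (𝓝 q)) :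
    Tendsto (fun n : ℕ => x n / (n + 1)) atTop (𝓝 0) := by
  have h1 := h.comp (tendsto_add_atTop_nat 1)
  have h2 : Tendsto (fun n : ℕ => (n : ℝ) / (n + 1)) atTop (𝓝 1) := tendsto_natCast_div_add_atTop 1
  have h3 := h1.sub (h2.mul h)
  rw [one_mul, sub_self] at h3
  refine h3.congr' ?_
  filter_upwards [eventually_gt_atTop 0] with n hn
  simp only [Function.comp, Finset.sum_range_succ]
  push_cast
  field_simp
  ring

/-- No single observation dominates; for a design made of the rows of one infinite matrix this
follows from the convergence of the Gram matrices. -/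
lemma IsAsymptoticDesign.negligible {d : ℕ} {X : ∀ n : ℕ, Matrix (Fin n) (Fin d) ℝ}
    {Q : Matrix (Fin d) (Fin d) ℝ} (hX : IsAsymptoticDesign X Q) {δ : ℝ} (hδ : 0 < δ) :
    ∀ᶠ n : ℕ in atTop, ∀ (i : Fin n) (j : Fin d), (X n i j) ^ 2 ≤ δ * n := by
  rcases hX.rows with ⟨x, hx⟩ | h
  swap; · exact h δ hδ
  have hj (j : Fin d) : ∀ᶠ n : ℕ in atTop, ∀ i : Fin n, (X n i j) ^ 2 ≤ δ * n := by
    have h1 := tendsto_pi_nhds.1 (tendsto_pi_nhds.1 hX.tendsto j) j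
    have h2 : Tendsto (fun n : ℕ => (n : ℝ)⁻¹ * ∑ i ∈ Finset.range n, x i j ^ 2) atTop
        (𝓝 (Q j j)) := by
      refine h1.congr fun n => ?_
      rw [Finset.sum_range]
      simp [Matrix.mul_apply, hx, sq]
    have h3 := (tendsto_div_succ_of_tendsto_average h2).eventually_lt_const (half_pos hδ)
    obtain ⟨N, hN⟩ := eventually_atTop.1 h3
    set M := ∑ i ∈ Finset.range N, x i j ^ 2 with hM
    have h4 : ∀ᶠ n : ℕ in atTop, M / (δ / 2) ≤ (n : ℝ) :=
      tendsto_natCast_atTop_atTop.eventually_ge_atTop _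
    filter_upwards [h4] with n hn i
    rw [div_le_iff₀ (half_pos hδ)] at hn
    rw [hx]
    have hi : ((i : ℕ) : ℝ) + 1 ≤ n := by exact_mod_cast i.2
    rcases lt_or_ge (i : ℕ) N with hiN | hiN
    · have h5 : x i j ^ 2 ≤ M :=
        Finset.single_le_sum (f := fun i => x i j ^ 2) (fun _ _ => sq_nonneg _)
          (Finset.mem_range.2 hiN)
      have : (0 : ℝ) ≤ n := Nat.cast_nonneg n
      nlinarith
    · have h5 := hN i hiN
      rw [div_lt_iff₀ (by positivity)] at h5
      have : (0 : ℝ) ≤ n := Nat.cast_nonneg n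
      nlinarith
  filter_upwards [eventually_all.2 hj] with n hn i j using hn j i

/-- The normalized noise term `n^{-1/2} Xᵀ ε`. -/
noncomputable def score {d : ℕ} {S : Type*} (X : ∀ n : ℕ, Matrix (Fin n) (Fin d) ℝ)
    (ε : ℕ → S → ℝ) (n : ℕ) (s : S) : Fin d → ℝ :=
  (√(n : ℝ))⁻¹ • ((X n)ᵀ *ᵥ fun i : Fin n => ε i s)

lemma score_dotProduct {d : ℕ} {S : Type*} (X : ∀ n : ℕ, Matrix (Fin n) (Fin d) ℝ)
    (ε : ℕ → S → ℝ) (n : ℕ) (s : S) (h : Fin d → ℝ) :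
    score X ε n s ⬝ᵥ h = ∑ i : Fin n, ((√(n : ℝ))⁻¹ * (X n *ᵥ h) i) * ε i s := by
  rw [score, smul_dotProduct, Matrix.mulVec_transpose, ← Matrix.dotProduct_mulVec, smul_eq_mul,
    dotProduct, Finset.mul_sum]
  exact Finset.sum_congr rfl fun i _ => by ring

lemma sum_sq_weights {d n : ℕ} (X : Matrix (Fin n) (Fin d) ℝ) (h : Fin d → ℝ) :
    ∑ i, ((√(n : ℝ))⁻¹ * (X *ᵥ h) i) ^ 2 = h ⬝ᵥ ((n : ℝ)⁻¹ • (Xᵀ * X)) *ᵥ h := by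
  have h1 : h ⬝ᵥ (Xᵀ * X) *ᵥ h = ∑ i, (X *ᵥ h) i ^ 2 := by
    rw [← Matrix.mulVec_mulVec, Matrix.dotProduct_mulVec, ← Matrix.mulVec_transpose,
      Matrix.transpose_transpose, dotProduct]
    exact Finset.sum_congr rfl fun i _ => by ring
  rw [Matrix.smul_mulVec, dotProduct_smul, h1, smul_eq_mul, Finset.mul_sum]
  refine Finset.sum_congr rfl fun i _ => ?_
  rw [mul_pow, inv_pow, Real.sq_sqrt (Nat.cast_nonneg n)]

lemma IsAsymptoticDesign.tendsto_sum_sq {d : ℕ} {X : ∀ n : ℕ, Matrix (Fin n) (Fin d) ℝ}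
    {Q : Matrix (Fin d) (Fin d) ℝ} (hX : IsAsymptoticDesign X Q) (h : Fin d → ℝ) :
    Tendsto (fun n : ℕ => ∑ i, ((√(n : ℝ))⁻¹ * (X n *ᵥ h) i) ^ 2) atTop (𝓝 (h ⬝ᵥ Q *ᵥ h)) := by
  simp_rw [sum_sq_weights]
  have hc : Continuous fun M : Matrix (Fin d) (Fin d) ℝ => h ⬝ᵥ M *ᵥ h := by
    simp only [dotProduct, Matrix.mulVec]; fun_prop
  exact (hc.tendsto Q).comp hX.tendsto

lemma IsAsymptoticDesign.weights_negligible {d : ℕ} {X : ∀ n : ℕ, Matrix (Fin n) (Fin d) ℝ}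
    {Q : Matrix (Fin d) (Fin d) ℝ} (hX : IsAsymptoticDesign X Q) (h : Fin d → ℝ) {δ : ℝ}
    (hδ : 0 < δ) :
    ∀ᶠ n : ℕ in atTop, ∀ i : Fin n, |(√(n : ℝ))⁻¹ * (X n *ᵥ h) i| ≤ δ := by
  obtain ⟨κ, hκ, hκδ⟩ := exists_pos_mul_lt hδ (∑ j, |h j|)
  filter_upwards [hX.negligible (pow_pos hκ 2), eventually_gt_atTop 0] with n hn hn0 i
  have hs : 0 < √(n : ℝ) := by positivity
  rw [abs_mul, abs_of_pos (inv_pos.2 hs), inv_mul_le_iff₀ hs]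
  have h1 (j : Fin d) : |X n i j| ≤ κ * √(n : ℝ) := by
    refine abs_le_of_sq_le_sq (b := κ * √(n : ℝ)) ?_ (by positivity)
    rw [mul_pow, Real.sq_sqrt (Nat.cast_nonneg n)]
    exact hn i j
  calc |(X n *ᵥ h) i| ≤ ∑ j, |X n i j * h j| := by
        simp only [Matrix.mulVec, dotProduct]
        exact Finset.abs_sum_le_sum_abs _ _
    _ ≤ ∑ j, κ * √(n : ℝ) * |h j| := Finset.sum_le_sum fun j _ => by
        rw [abs_mul]; gcongr; exact h1 j
    _ = √(n : ℝ) * ((∑ j, |h j|) * κ) := by rw [← Finset.mul_sum]; ring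
    _ ≤ √(n : ℝ) * δ := by gcongr

/-- The normalized noise term is bounded in probability. -/
lemma exists_measure_norm_score_le {d : ℕ} {S : Type*} [MeasurableSpace S] {P : Measure S}
    [IsProbabilityMeasure P] {ε : ℕ → S → ℝ} (hindep : iIndepFun ε P)
    (hident : ∀ i, IdentDistrib (ε i) (ε 0) P P) (hmem : MemLp (ε 0) 2 P)
    (hmean : ∫ s, ε 0 s ∂P = 0) {X : ∀ n : ℕ, Matrix (Fin n) (Fin d) ℝ}
    {Q : Matrix (Fin d) (Fin d) ℝ} (hX : IsAsymptoticDesign X Q) {δ : ℝ≥0∞} (hδ : 0 < δ) :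
    ∃ K : ℝ, 0 < K ∧ ∀ᶠ n : ℕ in atTop, P {s | K < ‖score X ε n s‖} ≤ δ := by
  set V := variance (ε 0) P with hV
  have hV0 : 0 ≤ V := variance_nonneg _ _
  set A := ∑ j, (|Q j j| + 1) * V with hA
  obtain ⟨K, hKδ, hK⟩ : ∃ K : ℝ, ENNReal.ofReal (A / K ^ 2) < δ ∧ 0 < K := by
    have h1 : Tendsto (fun K : ℝ => ENNReal.ofReal (A / K ^ 2)) atTop (𝓝 0) := by
      have h2 : Tendsto (fun K : ℝ => A / K ^ 2) atTop (𝓝 0) :=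
        (tendsto_pow_atTop two_ne_zero).const_div_atTop A
      exact ENNReal.ofReal_zero ▸ (ENNReal.continuous_ofReal.tendsto 0).comp h2
    exact ((h1.eventually_lt_const hδ).and (eventually_gt_atTop 0)).exists
  refine ⟨K, hK, ?_⟩
  have hq : ∀ᶠ n : ℕ in atTop, ∀ j : Fin d,
      ∑ i, ((√(n : ℝ))⁻¹ * (X n *ᵥ Pi.single j 1) i) ^ 2 ≤ |Q j j| + 1 := by
    refine eventually_all.2 fun j => ?_
    have h1 := hX.tendsto_sum_sq (Pi.single j 1)
    have h2 : (Pi.single j 1 : Fin d → ℝ) ⬝ᵥ Q *ᵥ Pi.single j 1 < |Q j j| + 1 := by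
      simpa using (le_abs_self (Q j j)).trans_lt (lt_add_one _)
    filter_upwards [h1.eventually_lt_const h2] with n hn using hn.le
  filter_upwards [hq] with n hn
  calc P {s | K < ‖score X ε n s‖}
      ≤ P (⋃ j : Fin d,
          {s | K ≤ |∑ i : Fin n, ((√(n : ℝ))⁻¹ * (X n *ᵥ Pi.single j 1) i) * ε i s|}) := by
        refine measure_mono fun s hs => ?_
        by_contra hcon
        simp only [Set.mem_iUnion, Set.mem_ofPred_eq, not_exists, not_le, ← score_dotProduct,
          dotProduct_single, mul_one] at hcon
        exact absurd ((pi_norm_le_iff_of_nonneg hK.le).2 fun j => (hcon j).le) (not_le.2 hs)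
    _ ≤ ∑ j : Fin d,
          P {s | K ≤ |∑ i : Fin n, ((√(n : ℝ))⁻¹ * (X n *ᵥ Pi.single j 1) i) * ε i s|} :=
        measure_iUnion_fintype_le _ _
    _ ≤ ∑ j : Fin d, ENNReal.ofReal ((|Q j j| + 1) * V / K ^ 2) := by
        refine Finset.sum_le_sum fun j _ => ?_
        refine (measure_weighted_sum_le hindep hident hmem hmean _ hK).trans ?_
        refine ENNReal.ofReal_le_ofReal ?_
        gcongr
        exact hn j
    _ = ENNReal.ofReal (A / K ^ 2) := by
        rw [← ENNReal.ofReal_sum_of_nonneg fun _ _ => by positivity, ← Finset.sum_div]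
    _ ≤ δ := hKδ.le

/-- The oracle map is self-adjoint on `ℝ^J`. -/
lemma oracle_dotProduct {d : ℕ} {Q : Matrix (Fin d) (Fin d) ℝ} (hQ : Q.PosDef)
    (J : Finset (Fin d)) (g : Fin d → ℝ) (t : J → ℝ) {t' : Fin d → ℝ} (ht : ∀ j : J, t' j = t j) :
    (fun i : J => oracle Q J g i) ⬝ᵥ t = g ⬝ᵥ oracle Q J t' := by
  set QJ := Q.submatrix (fun i : J => (i : Fin d)) (fun i : J => (i : Fin d)) with hQJ
  have hsym : (QJ⁻¹)ᵀ = QJ⁻¹ := by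
    have := (posDef_submatrix hQ J).isHermitian.inv
    rwa [Matrix.IsHermitian, Matrix.conjTranspose_eq_transpose_of_trivial] at this
  have h1 (g : Fin d → ℝ) :
      (fun i : J => oracle Q J g i) = QJ⁻¹ *ᵥ fun j : J => g j := by
    ext i; simp only [oracle, dif_pos i.2]; rfl
  have h2 : g ⬝ᵥ oracle Q J t' = (fun j : J => g j) ⬝ᵥ fun i : J => oracle Q J t' i := by
    simp only [dotProduct]
    rw [← Finset.sum_subset (Finset.subset_univ J), ← Finset.sum_coe_sort J]
    intro k _ hk
    simp [oracle, hk]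
  rw [h2, h1, h1, show (fun j : J => t' j) = t from funext ht, Matrix.dotProduct_mulVec,
    ← Matrix.mulVec_transpose, hsym]

/-- The oracle approximation is asymptotically normal: its linear functionals are weighted sums of
the noise, with weights whose squares sum to `⟨h, Q h⟩ = ⟨t, Q_JJ⁻¹ t⟩` in the limit, for
`h = Q_JJ⁻¹ t` extended by zero. -/
theorem tendstoInDistribution_oracle {d : ℕ} {S : Type*} [MeasurableSpace S] {P : Measure S}
    [IsProbabilityMeasure P] {ε : ℕ → S → ℝ} (hindep : iIndepFun ε P)
    (hident : ∀ i, IdentDistrib (ε i) (ε 0) P P) (hmem : MemLp (ε 0) 2 P)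
    (hmean : ∫ s, ε 0 s ∂P = 0) {X : ∀ n : ℕ, Matrix (Fin n) (Fin d) ℝ}
    {Q : Matrix (Fin d) (Fin d) ℝ} (hX : IsAsymptoticDesign X Q) (J : Finset (Fin d)) :
    TendstoInDistribution
      (fun n s => WithLp.toLp 2 fun i : J => oracle Q J (score X ε n s) i) atTop
      (id : EuclideanSpace ℝ J → EuclideanSpace ℝ J) (fun _ => P)
      (multivariateGaussian 0 (variance (ε 0) P •
        (Q.submatrix (fun i : J => (i : Fin d)) (fun i : J => (i : Fin d)))⁻¹)) := by
  have hQ := hX.posDef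
  -- a vector of `ℝ^J`, extended by zero
  set ext : EuclideanSpace ℝ J → Fin d → ℝ := fun t i => if h : i ∈ J then t.ofLp ⟨i, h⟩ else 0
    with hext
  have hextJ (t : EuclideanSpace ℝ J) (j : J) : ext t j = t.ofLp j := by simp [hext]
  refine tendstoInDistribution_of_weighted_sums hindep hident hmem hmean
    (a := fun t n i => (√(n : ℝ))⁻¹ * (X n *ᵥ oracle Q J (ext t)) i) ?_ ?_
    (posDef_submatrix hQ J).inv.posSemidef ?_
  · intro n t s
    rw [← score_dotProduct, ← oracle_dotProduct hQ J _ t.ofLp (hextJ t),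
      EuclideanSpace.inner_eq_star_dotProduct, dotProduct_comm]
    rfl
  · exact fun t δ hδ => hX.weights_negligible _ hδ
  · intro t
    convert hX.tendsto_sum_sq (oracle Q J (ext t)) using 2
    have h1 : oracle Q J (ext t) ⬝ᵥ Q *ᵥ oracle Q J (ext t) =
        ext t ⬝ᵥ oracle Q J (ext t) := by
      rw [dotProduct_comm]
      simp only [dotProduct]
      refine Finset.sum_congr rfl fun j _ => ?_
      by_cases hj : j ∈ J
      · rw [mulVec_oracle hQ _ hj]
      · simp [oracle, hj]
    rw [h1, ← oracle_dotProduct hQ J _ t.ofLp (hextJ t), dotProduct_comm]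
    congr 1
    ext i
    simp only [oracle, dif_pos i.2]
    congr 2
    ext j
    exact (hextJ t j).symm

/-! ### From deterministic bounds to convergence in probability -/

/-- The exceptional event, on which the estimator is not within `η` of its oracle approximation or
of the true parameter or has the wrong support, has vanishing probability. -/
theorem tendsto_measure_exceptional {d : ℕ} {Φ : (Fin d → ℝ) → EReal} {wstar : Fin d → ℝ}
    {α c r L : ℝ} (hα1 : α < 1)
    (hΦ : IsStablePenaltyAt Φ (supp wstar) (weighted α wstar wstar) c r L)
    {S : Type*} [MeasurableSpace S] {P : Measure S} [IsProbabilityMeasure P]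
    {ε : ℕ → S → ℝ} (hindep : iIndepFun ε P)
    (hident : ∀ i, IdentDistrib (ε i) (ε 0) P P) (hmem : MemLp (ε 0) 2 P)
    (hmean : ∫ s, ε 0 s ∂P = 0)
    {X : ∀ n : ℕ, Matrix (Fin n) (Fin d) ℝ} {Q : Matrix (Fin d) (Fin d) ℝ}
    (hX : IsAsymptoticDesign X Q)
    {w₀ : ℕ → S → Fin d → ℝ} (hw₀ : IsSqrtConsistent P w₀ wstar)
    {lam : ℕ → ℝ} (hlam_pos : ∀ n, 0 < lam n)
    (hlam_zero : Tendsto (fun n : ℕ => lam n / √(n : ℝ)) atTop (𝓝 0))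
    (hlam_top : Tendsto (fun n : ℕ => lam n / (n : ℝ) ^ (α / 2)) atTop atTop)
    {what : ℕ → S → Fin d → ℝ}
    (hwhat : ∀ᶠ n in atTop, ∀ᵐ s ∂P, ∀ w : Fin d → ℝ,
      adaptiveObjective Φ α (lam n) (X n) (fun i => (X n *ᵥ wstar) i + ε i s) (w₀ n s) (what n s) ≤
        adaptiveObjective Φ α (lam n) (X n) (fun i => (X n *ᵥ wstar) i + ε i s) (w₀ n s) w)
    {η : ℝ} (hη : 0 < η) :
    Tendsto (fun n : ℕ => P {s | ¬ (‖√(n : ℝ) • (what n s - wstar)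
        - oracle Q (supp wstar) (score X ε n s)‖ ≤ η ∧ supp (what n s) = supp wstar ∧
          ‖what n s - wstar‖ ≤ η)}) atTop (𝓝 0) := by
  refine ENNReal.tendsto_nhds_zero.2 fun δ hδ => ?_
  have hδ2 : 0 < δ / 2 := ENNReal.half_pos hδ.ne'
  obtain ⟨K₁, hK₁, h₁⟩ := exists_measure_norm_score_le hindep hident hmem hmean hX hδ2
  obtain ⟨K₂, h₂⟩ := hw₀ (δ / 2) hδ2
  filter_upwards [h₁, h₂, hwhat, eventually_estimator_bound hα1 hΦ hX.posDef hX.tendsto hlam_pos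
    hlam_zero hlam_top (lt_max_of_lt_left hK₁ : 0 < max K₁ K₂) hη] with n h₁ h₂ hmin hbd
  calc _ ≤ P ({s | K₁ < ‖score X ε n s‖} ∪ {s | K₂ < √(n : ℝ) * ‖w₀ n s - wstar‖}) := by
        refine measure_mono_ae ?_
        filter_upwards [hmin] with s hs hbad
        by_contra hcon
        have h3 : ¬ (K₁ < ‖score X ε n s‖ ∨ K₂ < √(n : ℝ) * ‖w₀ n s - wstar‖) := hcon
        push Not at h3
        exact hbad (hbd _ _ _ (h3.1.trans (le_max_left _ _)) (h3.2.trans (le_max_right _ _)) hs)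
    _ ≤ δ / 2 + δ / 2 := (measure_union_le _ _).trans (add_le_add h₁ h₂)
    _ = δ := ENNReal.add_halves δ

lemma norm_toLp_two_lt {d : ℕ} {J : Finset (Fin d)} {x : J → ℝ} {η : ℝ} (hη : 0 < η)
    (hx : ∀ i, |x i| ≤ η / (d + 1)) : ‖WithLp.toLp 2 x‖ < η := by
  rw [EuclideanSpace.norm_eq, Real.sqrt_lt' hη]
  calc ∑ i, ‖x i‖ ^ 2 ≤ ∑ _i : J, (η / (d + 1)) ^ 2 := by
        refine Finset.sum_le_sum fun i _ => ?_
        gcongr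
        exact hx i
    _ = (J.card : ℝ) * (η / (d + 1)) ^ 2 := by simp
    _ ≤ d * (η / (d + 1)) ^ 2 := by
        gcongr
        exact_mod_cast (Finset.card_le_univ J).trans_eq (Fintype.card_fin d)
    _ < η ^ 2 := by
        rw [div_pow, mul_div_assoc', div_lt_iff₀ (by positivity)]
        have hd : (0 : ℝ) ≤ d := Nat.cast_nonneg d
        have hlt : (d : ℝ) < (d + 1) ^ 2 := by nlinarith
        rw [mul_comm (η ^ 2)]
        gcongr

end CombPenalty


theorem mainTheorem6 {d : ℕ}
    -- the combinatorial penalty, the exponent, and the convex relaxation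
    (F : Finset (Fin d) → ℝ≥0∞) (hF : CombPenalty.IsCombPenalty F)
    (p : ℝ≥0∞) (hp : 1 < p)
    (Φ : (Fin d → ℝ) → EReal)
    (hΦ : Φ = CombPenalty.omegaEnv F p ∨ Φ = CombPenalty.thetaEnv F p)
    -- the true parameter, with strongly stable support
    (wstar : Fin d → ℝ)
    (hstable : CombPenalty.IsStronglyStable F (CombPenalty.supp wstar))
    (hbound : p = ∞ → ∀ i, |wstar i| < 1)
    (hfeas : p = ∞ → Φ = CombPenalty.thetaEnv F p → F (CombPenalty.supp wstar) < ∞)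
    -- the linear model `y = X wstar + ε` with `n` observations
    {S : Type*} [MeasurableSpace S] (P : Measure S) [IsProbabilityMeasure P]
    (ε : ℕ → S → ℝ) (σ : ℝ)
    (hε_indep : iIndepFun ε P)
    (hε_ident : ∀ i, IdentDistrib (ε i) (ε 0) P P)
    (hε_memLp : MemLp (ε 0) 2 P)
    (hε_mean : ∫ s, ε 0 s ∂P = 0)
    (hε_var : variance (ε 0) P = σ ^ 2)
    (X : ∀ n : ℕ, Matrix (Fin n) (Fin d) ℝ) (Q : Matrix (Fin d) (Fin d) ℝ)
    (hX : CombPenalty.IsAsymptoticDesign X Q)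
    (y : ∀ n : ℕ, S → Fin n → ℝ)
    (hy : ∀ n s i, y n s i = (X n *ᵥ wstar) i + ε i s)
    -- the adaptive weights and the regularization parameters
    (α : ℝ) (hα0 : 0 < α) (hα1 : α < 1)
    (w₀ : ℕ → S → Fin d → ℝ) (hw₀_meas : ∀ n, Measurable (w₀ n))
    (hw₀ : CombPenalty.IsSqrtConsistent P w₀ wstar)
    (lam : ℕ → ℝ) (hlam_pos : ∀ n, 0 < lam n)
    (hlam_zero : Tendsto (fun n : ℕ => lam n / √(n : ℝ)) atTop (𝓝 0))
    (hlam_top : Tendsto (fun n : ℕ => lam n / (n : ℝ) ^ (α / 2)) atTop atTop)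
    -- the adaptive estimator
    (what : ℕ → S → Fin d → ℝ) (hwhat_meas : ∀ n, Measurable (what n))
    (hwhat : ∀ᶠ n in atTop, ∀ᵐ s ∂P, ∀ w : Fin d → ℝ,
      CombPenalty.adaptiveObjective Φ α (lam n) (X n) (y n s) (w₀ n s) (what n s) ≤
        CombPenalty.adaptiveObjective Φ α (lam n) (X n) (y n s) (w₀ n s) w) :
    -- consistency
    TendstoInMeasure P what atTop (fun _ => wstar) ∧
    -- asymptotic normality on the true support `J`, with covariance `σ² (Q_JJ)⁻¹`
    TendstoInDistribution
      (fun (n : ℕ) (s : S) => WithLp.toLp 2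
        fun i : CombPenalty.supp wstar => √(n : ℝ) * (what n s i - wstar i))
      atTop
      (id : EuclideanSpace ℝ (CombPenalty.supp wstar) →
        EuclideanSpace ℝ (CombPenalty.supp wstar))
      (fun _ => P)
      (multivariateGaussian 0 (σ ^ 2 •
        (Q.submatrix (fun i : CombPenalty.supp wstar => (i : Fin d))
          (fun i : CombPenalty.supp wstar => (i : Fin d)))⁻¹)) ∧
    -- support recovery
    Tendsto (fun n : ℕ => P {s | CombPenalty.supp (what n s) = CombPenalty.supp wstar})
      atTop (𝓝 1) := by
  -- the weighted true parameter is `|w*|^α`, which lies inside the unit cube if `w*` does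
  obtain ⟨c, r, L, hpen⟩ := CombPenalty.exists_isStablePenaltyAt hF hp hΦ hstable
    (CombPenalty.weighted α wstar wstar) (fun hp' i => by
      rcases eq_or_ne (wstar i) 0 with h0 | h0
      · simp [CombPenalty.weighted, h0]
      · have h1 : 0 < |wstar i| := abs_pos.2 h0
        rw [CombPenalty.weighted, ← Real.rpow_add_one h1.ne', sub_add_cancel,
          abs_of_nonneg (by positivity)]
        exact Real.rpow_lt_one h1.le (hbound hp' i) hα0) hfeas
  have hy' (n : ℕ) (s : S) : y n s = fun i : Fin n => (X n *ᵥ wstar) i + ε i s :=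
    funext (hy n s)
  simp_rw [hy'] at hwhat
  have hexc {η : ℝ} (hη : 0 < η) := CombPenalty.tendsto_measure_exceptional hα1 hpen hε_indep
    hε_ident hε_memLp hε_mean hX hw₀ hlam_pos hlam_zero hlam_top hwhat hη
  refine ⟨?_, ?_, ?_⟩
  · refine tendstoInMeasure_iff_norm.2 fun η hη => ?_
    refine tendsto_of_tendsto_of_tendsto_of_le_of_le tendsto_const_nhds (hexc (half_pos hη))
      (fun _ => zero_le) fun n => measure_mono fun s hs hgood => ?_
    have hs' : η ≤ ‖what n s - wstar‖ := hs
    linarith [hgood.2.2]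
  · rw [← hε_var]
    refine tendstoInDistribution_of_tendstoInMeasure_sub _ _
      (CombPenalty.tendstoInDistribution_oracle hε_indep hε_ident hε_memLp hε_mean hX
        (CombPenalty.supp wstar)) ?_ fun n => ?_
    · refine tendstoInMeasure_iff_norm.2 fun η hη => ?_
      refine tendsto_of_tendsto_of_tendsto_of_le_of_le tendsto_const_nhds
        (hexc (show 0 < η / (d + 1) by positivity))
        (fun _ => zero_le) fun n => measure_mono fun s hs hgood => ?_
      refine absurd (CombPenalty.norm_toLp_two_lt (J := CombPenalty.supp wstar) hη fun i =>
        (norm_le_pi_norm _ (i : Fin d)).trans hgood.1) (not_lt.2 ?_)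
      have hs' := hs
      simp only [Pi.sub_apply, Pi.zero_apply, sub_zero, Set.mem_ofPred_eq] at hs'
      exact hs'
    · refine ((WithLp.measurable_toLp 2 _).comp ?_).aemeasurable
      exact measurable_pi_lambda _ fun i =>
        (((measurable_pi_apply (i : Fin d)).comp (hwhat_meas n)).sub_const _).const_mul _
  · have h1 := hexc one_pos
    have h2 := ENNReal.Tendsto.sub (tendsto_const_nhds (x := (1 : ℝ≥0∞))) h1
      (.inl ENNReal.one_ne_top)
    rw [tsub_zero] at h2
    refine tendsto_of_tendsto_of_tendsto_of_le_of_le h2 tendsto_const_nhds (fun n => ?_)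
      fun n => prob_le_one
    rw [tsub_le_iff_right, ← measure_univ (μ := P)]
    refine (measure_mono fun s _ => ?_).trans (measure_union_le _ _)
    by_cases h : CombPenalty.supp (what n s) = CombPenalty.supp wstar
    · exact .inl h
    · exact .inr fun hgood => h hgood.2.1
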